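/- \textbf{Setting.} All rings are commutative with unit and homomorphisms preserve the unit. A differential ring $(A,\partial)$ is a ring $A$ with a derivation $\partial$; its constants are $\ker\partial$. It is an integro-differential ring $(A,\partial,\int)$ if $\int:A\to A$ is $\ker(\partial)$-linear with $\partial\int=\mathrm{id}$. An integro-differential ring homomorphism is a ring homomorphism commuting with $\partial$ and $\int$; an integro-differential ideal is an ideal closed under $\partial$ and $\int$. Let $(R,\partial,Q)$ be a commutative quasi-integro-differential ring: $(R,\partial)$ is a commutative differential ring with ring of constants $C$, and $Q:R\to R$ is $C$-linear with $\partial Q\partial=\partial$ and $Q\partial Q=Q$. Put $R_J=QR$ and $R_T=\ker Q$. Tensor products, symmetric products $\odot$ and symmetric algebras $\mathrm{Sym}$ are over $C$. \textbf{Construction.} Let $T=\bigoplus_{n\ge0}R_T^{\otimes n}$ with empty tensor $1_T$, and $\widetilde T=\bigoplus_{n\ge1}R_T^{\otimes n}$. For a pure tensor $f=f_1\otimes\dots\otimes f_n$ write $f_i^j=f_i\otimes\dots\otimes f_j$ (with $f_i^{i-1}=1_T$). Let $\star$ denote the shuffle product on $T$: $1_T\star g=g$, $f\star 1_T=f$,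 and $f\star g=f_1\otimes(f_2^n\star g)+g_1\otimes(f\star g_2^m)$ for pure tensors $f,g$ of lengths $n,m\ge1$. Let $$C_1=\mathrm{Sym}(R_J\otimes T),\qquad \widetilde C_1=\mathrm{Sym}(R_J\otimes\widetilde T),\qquad C_2=\mathrm{Sym}(\widetilde T\odot\widetilde T)/J_2,$$ where $\varepsilon(\cdot)$ denotes the generators of each of these algebras, $\varepsilon(g):=\varepsilon(g\otimes1_T)\in C_1$ for $g\in R_J$, and $J_2$ is the ideal generated by $$\varepsilon((f\star g)\odot h)-\varepsilon(f\odot(g\star h))+\sum_{j=0}^{m-1}\Big(\sum_{i=\max(0,1-j)}^{n-1}\varepsilon(f_{i+1}^n\odot g_{j+1}^m)\,\varepsilon((f_1^i\star g_1^j)\odot h)-\sum_{k=\max(0,1-j)}^{l-1}\varepsilon(f\odot(g_1^j\star h_1^k))\,\varepsilon(g_{j+1}^m\odot h_{k+1}^l)\Big)$$ for all pure tensors $f,g,h$ over $R_T$ of lengths $n,m,l\ge1$. The module $C_2\otimes T$ is a commutative $C$-algebra with the bilinear product $$(c\otimes f)\cdot(d\otimes g)=cd\otimes(f\star g)+\sum_{i=0}^{n-1}\sum_{j=0}^{m-1}cd\,\varepsilon(f_{i+1}^n\odot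 g_{j+1}^m)\otimes(f_1^i\star g_1^j)$$ for pure tensors $f,g$ of lengths $n,m\ge0$. As tensor products of the $C$-algebras $R$, $C_1$ (resp. $\widetilde C_1$) and $C_2\otimes T$, define $$\mathrm{IDR}(R)=R\otimes C_1\otimes C_2\otimes T,\qquad \mathrm{IDR}_Q(R)=R\otimes\widetilde C_1\otimes C_2\otimes T,$$ and, in both, $\iota(f)=f\otimes1\otimes1\otimes1_T$ for $f\in R$. In both, $\partial$ is the $C$-linear map with $$\partial(f_0\otimes c\otimes 1_T)=\partial f_0\otimes c\otimes 1_T,\qquad \partial(f_0\otimes c\otimes f)=\partial f_0\otimes c\otimes f+f_0f_1\otimes c\otimes f_2^n\quad(n\ge1),$$ where $c=c_1\otimes c_2$. The map $\int$ is $C$-linear and is given, for a pure tensor $f$ of length $n\ge1$ in both rings, recursively by $$\int(f_0\otimes c\otimes f)=Qf_0\otimes c\otimes f-1\otimes c_1\varepsilon(Qf_0\otimes f)\otimes c_2\otimes1_T-\int((Qf_0)f_1\otimes c\otimes f_2^n)+1\otimes c\otimes((f_0-\partial Qf_0)\otimes f);$$ for the empty tensor it is given on $\mathrm{IDR}(R)$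 by $$\int(f_0\otimes c\otimes1_T)=Qf_0\otimes c\otimes1_T-1\otimes c_1\varepsilon(Qf_0)\otimes c_2\otimes1_T+1\otimes c\otimes(f_0-\partial Qf_0)$$ and on $\mathrm{IDR}_Q(R)$ by the same formula without the middle term. \textbf{Theorem.} \begin{enumerate} \item $(\mathrm{IDR}_Q(R),\partial,\int)$ is a commutative integro-differential ring. \item $\iota:R\to\mathrm{IDR}_Q(R)$ is an injective differential ring homomorphism, and $\int\iota(f)=\iota(Qf)$ for all $f\in\partial R$. \item Let $J_1\subseteq\mathrm{IDR}(R)$ be the integro-differential ideal generated by the constants $1\otimes\varepsilon(Q\partial f)\otimes1\otimes1_T$, $f\in R$, and let $\pi:\mathrm{IDR}(R)\to\mathrm{IDR}(R)/J_1$ be the projection. There is an integro-differential ring homomorphism $\psi:\mathrm{IDR}(R)/J_1\to\mathrm{IDR}_Q(R)$, for the operations induced on the quotient, with $\psi(\pi(\iota(f)))=\iota(f)$ for all $f\in R$; it is bijective, and it is the only integro-differential ring homomorphism with this property. \end{enumerate} -/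

import Mathlib

open scoped TensorProduct

universe u v

namespace IDRing

lemma ofFn_update {V : Type v} {n : ℕ} (m : Fin n → V) (i : Fin n) (x : V) :
    List.ofFn (Function.update m i x) =
      (List.ofFn m).take i ++ x :: (List.ofFn m).drop (i + 1) := by
  have h : List.ofFn (Function.update m i x) = (List.ofFn m).set i x := by
    apply List.ext_getElem
    · simp
    · intro k h1 h2
      simp only [List.getElem_ofFn, List.getElem_set, Function.update_apply]
      by_cases hk : (i : ℕ) = k
      · subst hk
        simp
      · rw [if_neg hk, if_neg]
        intro h
        apply hk
        rw [← h]
  rw [h, List.set_eq_take_append_cons_drop, if_pos (by simp)]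

section Words

variable {C : Type u} {V : Type v} [CommRing C] [AddCommGroup V] [Module C V]

/-- The pure tensor `v₁ ⊗ ⋯ ⊗ vₙ` of the tensor algebra given by the list `[v₁, …, vₙ]`;
the empty list gives the empty tensor `1`. -/
noncomputable def word (C : Type u) {V : Type v} [CommRing C] [AddCommGroup V] [Module C V]
    (l : List V) : TensorAlgebra C V :=
  (l.map (TensorAlgebra.ι C)).prod

@[simp] lemma word_nil : word C ([] : List V) = 1 := rfl

@[simp] lemma word_cons (x : V) (l : List V) :
    word C (x :: l) = TensorAlgebra.ι C x * word C l := by simp [word]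

lemma word_append (l m : List V) : word C (l ++ m) = word C l * word C m := by simp [word]

/-- A function on lists that is `C`-linear in each entry of the list. -/
structure WordMultilinear (C : Type u) {V : Type v} {M : Type*} [CommRing C] [AddCommGroup V]
    [Module C V] [AddCommGroup M] [Module C M] (F : List V → M) : Prop where
  add : ∀ (a b : List V) (x y : V), F (a ++ (x + y) :: b) = F (a ++ x :: b) + F (a ++ y :: b)
  smul : ∀ (a b : List V) (c : C) (x : V), F (a ++ (c • x) :: b) = c • F (a ++ x :: b)

variable {M : Type*} [AddCommGroup M] [Module C M]

/-- The linear map on the tensor algebra that takes prescribed values on pure tensors. -/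
noncomputable def wordLift (F : List V → M) (hF : WordMultilinear C F) :
    TensorAlgebra C V →ₗ[C] M :=
  (DirectSum.toModule C ℕ M fun n => PiTensorProduct.lift
    { toFun := fun m : Fin n → V => F (List.ofFn m)
      map_update_add' := by
        intro inst m i x y
        have := Subsingleton.elim inst (instDecidableEqFin n)
        subst this
        simp only [ofFn_update, hF.add]
      map_update_smul' := by
        intro inst m i c x
        have := Subsingleton.elim inst (instDecidableEqFin n)
        subst this
        simp only [ofFn_update, hF.smul] }) ∘ₗ
    (TensorAlgebra.toDirectSum (R := C) (M := V)).toLinearMap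

@[simp] lemma wordLift_word (F : List V → M) (hF : WordMultilinear C F) (l : List V) :
    wordLift F hF (word C l) = F l := by
  have h : word C l = TensorAlgebra.tprod C V l.length l.get := by
    rw [TensorAlgebra.tprod_apply, word]
    congr 1
    apply List.ext_getElem <;> simp
  simp only [wordLift, LinearMap.comp_apply, AlgHom.toLinearMap_apply]
  rw [h, TensorAlgebra.toDirectSum_tensorPower_tprod, ← DirectSum.lof_eq_of C,
    DirectSum.toModule_lof, PiTensorProduct.lift.tprod]
  simp

lemma span_words : Submodule.span C (Set.range (word C : List V → TensorAlgebra C V)) = ⊤ := by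
  rw [eq_top_iff]
  rintro x -
  induction x using TensorAlgebra.induction with
  | algebraMap r =>
    rw [Algebra.algebraMap_eq_smul_one]
    exact Submodule.smul_mem _ _ (Submodule.subset_span ⟨[], rfl⟩)
  | ι x => exact Submodule.subset_span ⟨[x], by simp⟩
  | add a b ha hb => exact Submodule.add_mem _ ha hb
  | mul a b ha hb =>
    have : ∀ a b, a ∈ Submodule.span C (Set.range (word C : List V → TensorAlgebra C V)) →
        b ∈ Submodule.span C (Set.range (word C : List V → TensorAlgebra C V)) →
        a * b ∈ Submodule.span C (Set.range (word C : List V → TensorAlgebra C V)) := by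
      intro a b ha hb
      have h := Submodule.mul_mem_mul ha hb
      rw [Submodule.span_mul_span] at h
      refine Submodule.span_mono ?_ h
      rintro _ ⟨_, ⟨l, rfl⟩, _, ⟨m, rfl⟩, rfl⟩
      exact ⟨l ++ m, by simp [word]⟩
    exact this a b ha hb

lemma word_hom_ext {f g : TensorAlgebra C V →ₗ[C] M} (h : ∀ l, f (word C l) = g (word C l)) :
    f = g :=
  LinearMap.ext_on_range span_words h

/-- The bilinear map on the tensor algebra that takes prescribed values on pure tensors. -/
noncomputable def wordLift₂ (F : List V → List V → M) (h₁ : ∀ g, WordMultilinear C fun f => F f g)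
    (h₂ : ∀ f, WordMultilinear C (F f)) :
    TensorAlgebra C V →ₗ[C] TensorAlgebra C V →ₗ[C] M :=
  wordLift (fun f => wordLift (F f) (h₂ f))
    { add := fun a b x y => word_hom_ext fun l => by simp [(h₁ l).add a b x y]
      smul := fun a b c x => word_hom_ext fun l => by simp [(h₁ l).smul a b c x] }

@[simp] lemma wordLift₂_word (F : List V → List V → M)
    (h₁ : ∀ g, WordMultilinear C fun f => F f g) (h₂ : ∀ f, WordMultilinear C (F f))
    (f g : List V) : wordLift₂ F h₁ h₂ (word C f) (word C g) = F f g := by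
  simp [wordLift₂]

/-- The shuffle product of two pure tensors. -/
noncomputable def shuffle (C : Type u) {V : Type v} [CommRing C] [AddCommGroup V] [Module C V] :
    List V → List V → TensorAlgebra C V
  | [], g => word C g
  | f, [] => word C f
  | x :: f, y :: g =>
      TensorAlgebra.ι C x * shuffle C f (y :: g) + TensorAlgebra.ι C y * shuffle C (x :: f) g
termination_by f g => f.length + g.length

@[simp] lemma shuffle_nil_left (g : List V) : shuffle C [] g = word C g := by
  simp [shuffle]

@[simp] lemma shuffle_nil_right (f : List V) : shuffle C f [] = word C f := by
  cases f <;> simp [shuffle]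

lemma shuffle_cons_cons (x y : V) (f g : List V) :
    shuffle C (x :: f) (y :: g) =
      TensorAlgebra.ι C x * shuffle C f (y :: g) + TensorAlgebra.ι C y * shuffle C (x :: f) g := by
  rw [shuffle]

lemma shuffle_comm (f g : List V) : shuffle C f g = shuffle C g f := by
  induction f generalizing g with
  | nil => simp
  | cons x f ihf =>
    induction g with
    | nil => simp
    | cons y g ihg => rw [shuffle_cons_cons, shuffle_cons_cons, ihf, ihg, add_comm]

end Words

section GeneralizedShuffle

variable (C : Type u) (V : Type v) [CommRing C] [AddCommGroup V] [Module C V]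

/-- The tensors of positive degree, `⨁_{n ≥ 1} V^{⊗ n}`, as a submodule of the tensor algebra:
the kernel of the projection onto the component of degree `0`. -/
noncomputable def PosTensor : Submodule C (TensorAlgebra C V) :=
  LinearMap.ker (TensorAlgebra.algebraMapInv (R := C) (M := V)).toLinearMap

variable {C V} in
lemma algebraMapInv_word_cons (x : V) (l : List V) :
    TensorAlgebra.algebraMapInv (R := C) (word C (x :: l)) = 0 := by
  simp [TensorAlgebra.algebraMapInv]

variable {C V} in
lemma sub_mem_posTensor (t : TensorAlgebra C V) :
    (LinearMap.id - Algebra.linearMap C (TensorAlgebra C V) ∘ₗ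
      (TensorAlgebra.algebraMapInv (R := C) (M := V)).toLinearMap :
        TensorAlgebra C V →ₗ[C] TensorAlgebra C V) t ∈ PosTensor C V := by
  rw [PosTensor, LinearMap.mem_ker]
  simp [TensorAlgebra.algebraMap_leftInverse V _]

/-- The projection of the tensor algebra onto the tensors of positive degree. It fixes every
nonempty pure tensor and sends the empty tensor to `0`. -/
noncomputable def posProj : TensorAlgebra C V →ₗ[C] PosTensor C V :=
  LinearMap.codRestrict (PosTensor C V)
    (LinearMap.id - Algebra.linearMap C (TensorAlgebra C V) ∘ₗ
      (TensorAlgebra.algebraMapInv (R := C) (M := V)).toLinearMap) sub_mem_posTensor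

lemma coe_posProj (t : TensorAlgebra C V) : (posProj C V t : TensorAlgebra C V) =
    t - algebraMap C (TensorAlgebra C V) (TensorAlgebra.algebraMapInv t) := rfl

@[simp] lemma posProj_one : posProj C V 1 = 0 := by
  apply Subtype.ext
  rw [coe_posProj]
  simp

lemma posProj_word_cons (x : V) (l : List V) :
    (posProj C V (word C (x :: l)) : TensorAlgebra C V) = word C (x :: l) := by
  rw [coe_posProj, algebraMapInv_word_cons, map_zero, sub_zero]

/-- The symmetric square `N ⊙ N` of a module. -/
abbrev SymSq (N : Type*) [AddCommGroup N] [Module C N] : Type _ :=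
  (N ⊗[C] N) ⧸ Submodule.span C {x : N ⊗[C] N | ∃ f g : N, x = f ⊗ₜ[C] g - g ⊗ₜ[C] f}

/-- The symmetric algebra on `T̃ ⊙ T̃`, with `T̃` the module of tensors of positive degree. -/
abbrev SymM₂ : Type _ := SymmetricAlgebra C (SymSq C (PosTensor C V))

/-- The generators `ε(f ⊙ g)`, bilinear in `f` and `g`. (For tensors `f` or `g` that are not
of positive degree, the component of positive degree is taken.) -/
noncomputable def epsSym :
    TensorAlgebra C V →ₗ[C] TensorAlgebra C V →ₗ[C] SymM₂ C V :=
  ((TensorProduct.mk C (PosTensor C V) (PosTensor C V)).compl₁₂ (posProj C V)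
    (posProj C V)).compr₂ (SymmetricAlgebra.ι C _ ∘ₗ Submodule.mkQ _)

lemma epsSym_apply (f g : TensorAlgebra C V) :
    epsSym C V f g = SymmetricAlgebra.ι C (SymSq C (PosTensor C V))
      (Submodule.Quotient.mk (posProj C V f ⊗ₜ[C] posProj C V g)) := rfl

lemma epsSym_comm (f g : TensorAlgebra C V) : epsSym C V f g = epsSym C V g f := by
  rw [epsSym_apply, epsSym_apply]
  congr 1
  rw [Submodule.Quotient.eq]
  exact Submodule.subset_span ⟨_, _, rfl⟩

/-- The relation of constants given by three pure tensors `f`, `g` and `h`. With 0-based lists,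
`f.take i` is `f₁ ⊗ ⋯ ⊗ fᵢ` and `f.drop i` is `fᵢ₊₁ ⊗ ⋯ ⊗ fₙ`; the truncated subtraction
`1 - j` is `max (0, 1 - j)`. -/
noncomputable def constRel (f g h : List V) : SymM₂ C V :=
  epsSym C V (shuffle C f g) (word C h) - epsSym C V (word C f) (shuffle C g h) +
    ∑ j ∈ Finset.range g.length,
      ((∑ i ∈ Finset.Ico (1 - j) f.length,
          epsSym C V (word C (f.drop i)) (word C (g.drop j)) *
            epsSym C V (shuffle C (f.take i) (g.take j)) (word C h)) -
        ∑ k ∈ Finset.Ico (1 - j) h.length,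
          epsSym C V (word C f) (shuffle C (g.take j) (h.take k)) *
            epsSym C V (word C (g.drop j)) (word C (h.drop k)))

/-- The ideal generated by the relations of constants. -/
noncomputable def relIdeal : Ideal (SymM₂ C V) :=
  Ideal.span {x | ∃ f g h : List V, f ≠ [] ∧ g ≠ [] ∧ h ≠ [] ∧ x = constRel C V f g h}

/-- The algebra of the new constants that arise from products of nested integrals. -/
def C₂ : Type _ := SymM₂ C V ⧸ relIdeal C V

noncomputable instance : CommRing (C₂ C V) :=
  inferInstanceAs (CommRing (SymM₂ C V ⧸ relIdeal C V))
noncomputable instance : Algebra C (C₂ C V) :=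
  inferInstanceAs (Algebra C (SymM₂ C V ⧸ relIdeal C V))

/-- The canonical projection onto `C₂`. -/
noncomputable def toC₂ : SymM₂ C V →ₐ[C] C₂ C V := Ideal.Quotient.mkₐ C (relIdeal C V)

/-- The constants `ε(f ⊙ g)` in `C₂`. -/
noncomputable def eps₂ : TensorAlgebra C V →ₗ[C] TensorAlgebra C V →ₗ[C] C₂ C V :=
  (epsSym C V).compr₂ (toC₂ C V).toLinearMap

/-- The module `C₂ ⊗ T`, as a type of its own since its product is not the tensor product of
the products of the two factors. -/
def GenShuffle : Type _ := C₂ C V ⊗[C] TensorAlgebra C V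

noncomputable instance : AddCommGroup (GenShuffle C V) :=
  inferInstanceAs (AddCommGroup (C₂ C V ⊗[C] TensorAlgebra C V))
noncomputable instance : Module C (GenShuffle C V) :=
  inferInstanceAs (Module C (C₂ C V ⊗[C] TensorAlgebra C V))
noncomputable instance : Module (C₂ C V) (GenShuffle C V) :=
  inferInstanceAs (Module (C₂ C V) (C₂ C V ⊗[C] TensorAlgebra C V))
instance : IsScalarTower C (C₂ C V) (GenShuffle C V) :=
  inferInstanceAs (IsScalarTower C (C₂ C V) (C₂ C V ⊗[C] TensorAlgebra C V))

namespace GenShuffle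

/-- The element `c ⊗ t` of `C₂ ⊗ T`, bilinear in `c` and `t`. -/
noncomputable def mk : C₂ C V →ₗ[C] TensorAlgebra C V →ₗ[C] GenShuffle C V :=
  TensorProduct.mk C (C₂ C V) (TensorAlgebra C V)

variable {C V}

lemma smul_mk (b c : C₂ C V) (t : TensorAlgebra C V) : b • mk C V c t = mk C V (b * c) t := rfl

variable (C V)

/-- The product `(1 ⊗ f) · (1 ⊗ g)` for pure tensors `f` and `g`. -/
noncomputable def mulWord (f g : List V) : GenShuffle C V :=
  mk C V 1 (shuffle C f g) +
    ∑ i ∈ Finset.range f.length, ∑ j ∈ Finset.range g.length,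
      mk C V (eps₂ C V (word C (f.drop i)) (word C (g.drop j))) (shuffle C (f.take i) (g.take j))

/-- The map `c ⊗ t ↦ c ⊗ (x ⊗ t)`. -/
noncomputable def consL (x : V) : GenShuffle C V →ₗ[C₂ C V] GenShuffle C V :=
  LinearMap.baseChange (C₂ C V) (LinearMap.mulLeft C (TensorAlgebra.ι C x))

@[simp] lemma consL_mk (x : V) (c : C₂ C V) (t : TensorAlgebra C V) :
    consL C V x (mk C V c t) = mk C V c (TensorAlgebra.ι C x * t) := rfl

variable {C V}

lemma induction {p : GenShuffle C V → Prop} (x : GenShuffle C V) (h0 : p 0)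
    (hmk : ∀ c l, p (mk C V c (word C l))) (hadd : ∀ x y, p x → p y → p (x + y)) : p x := by
  refine TensorProduct.induction_on (motive := p) x h0 (fun c t => ?_) hadd
  change p (mk C V c t)
  have ht : t ∈ Submodule.span C (Set.range (word C : List V → TensorAlgebra C V)) := by
    rw [span_words]; trivial
  induction ht using Submodule.span_induction generalizing c with
  | mem t h => obtain ⟨l, rfl⟩ := h; exact hmk c l
  | zero => rw [map_zero]; exact h0
  | add a b _ _ ha hb => rw [map_add]; exact hadd _ _ (ha c) (hb c)
  | smul r a _ ha =>
    rw [map_smul, ← LinearMap.smul_apply, ← map_smul]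
    exact ha (r • c)

lemma consL_add (x y : V) (t : GenShuffle C V) :
    consL C V (x + y) t = consL C V x t + consL C V y t := by
  induction t using induction with
  | h0 => simp
  | hmk c l => simp [add_mul]
  | hadd a b ha hb => rw [map_add, map_add, map_add, ha, hb]; abel

lemma consL_smul (c : C) (x : V) (t : GenShuffle C V) :
    consL C V (c • x) t = c • consL C V x t := by
  induction t using induction with
  | h0 => simp
  | hmk c l => simp
  | hadd a b ha hb => rw [map_add, map_add, ha, hb, smul_add]

@[simp] lemma mulWord_nil_left (g : List V) : mulWord C V [] g = mk C V 1 (word C g) := by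
  simp [mulWord]

@[simp] lemma mulWord_nil_right (f : List V) : mulWord C V f [] = mk C V 1 (word C f) := by
  simp [mulWord]

lemma eps₂_comm (f g : TensorAlgebra C V) : eps₂ C V f g = eps₂ C V g f := by
  simp only [eps₂, LinearMap.compr₂_apply, epsSym_comm C V f g]

lemma mulWord_comm (f g : List V) : mulWord C V f g = mulWord C V g f := by
  rw [mulWord, mulWord, Finset.sum_comm, shuffle_comm]
  congr 1
  refine Finset.sum_congr rfl fun j _ => Finset.sum_congr rfl fun i _ => ?_
  rw [eps₂_comm, shuffle_comm]

lemma mulWord_cons_cons (x y : V) (f g : List V) :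
    mulWord C V (x :: f) (y :: g) =
      consL C V x (mulWord C V f (y :: g)) + consL C V y (mulWord C V (x :: f) g) +
        mk C V (eps₂ C V (word C (x :: f)) (word C (y :: g))) 1 := by
  simp only [mulWord, List.length_cons, Finset.sum_range_succ', List.drop_succ_cons,
    List.take_succ_cons, List.drop_zero, List.take_zero, shuffle_nil_left, shuffle_nil_right,
    shuffle_cons_cons, map_add, map_sum, consL_mk, Finset.sum_add_distrib, word_nil,
    word_cons]
  abel

lemma mulWord_multilinear_left (g : List V) :
    WordMultilinear C fun f => mulWord C V f g where
  add a b x y := by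
    induction a generalizing g with
    | nil =>
      induction g with
      | nil => simp [add_mul]
      | cons w g ih =>
        simp only [List.nil_append] at ih ⊢
        simp only [mulWord_cons_cons, ih, consL_add, word_cons, map_add, add_mul,
          LinearMap.add_apply]
        abel
    | cons u a iha =>
      induction g with
      | nil => simp [word_append, mul_add, add_mul]
      | cons w g ih =>
        simp only [List.cons_append] at ih ⊢
        simp only [mulWord_cons_cons, ih, iha, word_cons, word_append, map_add, add_mul, mul_add,
          LinearMap.add_apply]
        abel
  smul a b c x := by
    induction a generalizing g with
    | nil =>
      induction g with
      | nil => simp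
      | cons w g ih =>
        simp only [List.nil_append] at ih ⊢
        simp only [mulWord_cons_cons, ih, consL_smul, word_cons, map_smul, smul_mul_assoc,
          LinearMap.smul_apply, LinearMap.map_smul_of_tower, smul_add]
    | cons u a iha =>
      induction g with
      | nil => simp [word_append]
      | cons w g ih =>
        simp only [List.cons_append] at ih ⊢
        simp only [mulWord_cons_cons, ih, iha, word_cons, word_append, map_smul, smul_mul_assoc,
          mul_smul_comm, LinearMap.smul_apply, LinearMap.map_smul_of_tower, smul_add]

lemma mulWord_multilinear_right (f : List V) : WordMultilinear C (mulWord C V f) := by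
  rw [show mulWord C V f = fun g => mulWord C V g f from funext fun g => mulWord_comm f g]
  exact mulWord_multilinear_left f

variable (C V)

/-- The product `(1 ⊗ s) · (1 ⊗ t)` for tensors `s` and `t`. -/
noncomputable def mulTensor : TensorAlgebra C V →ₗ[C] TensorAlgebra C V →ₗ[C] GenShuffle C V :=
  wordLift₂ (mulWord C V) mulWord_multilinear_left mulWord_multilinear_right

/-- The extension of a linear map on `T` to a `C₂`-linear map on `C₂ ⊗ T`. -/
noncomputable def extend {N : Type*} [AddCommGroup N] [Module C N] [Module (C₂ C V) N]
    [IsScalarTower C (C₂ C V) N] :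
    (TensorAlgebra C V →ₗ[C] N) →ₗ[C] (GenShuffle C V →ₗ[C₂ C V] N) :=
  ((LinearMap.liftBaseChangeEquiv (R := C) (M := TensorAlgebra C V) (N := N)
    (C₂ C V)).restrictScalars C).toLinearMap

variable {C V} in
lemma extend_mk {N : Type*} [AddCommGroup N] [Module C N] [Module (C₂ C V) N]
    [IsScalarTower C (C₂ C V) N] (φ : TensorAlgebra C V →ₗ[C] N) (c : C₂ C V)
    (t : TensorAlgebra C V) : extend C V φ (mk C V c t) = c • φ t :=
  LinearMap.liftBaseChange_tmul _ _ _ _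

/-- The product of `C₂ ⊗ T` as a bilinear map. -/
noncomputable def mulHom :
    GenShuffle C V →ₗ[C₂ C V] GenShuffle C V →ₗ[C₂ C V] GenShuffle C V :=
  extend C V (extend C V ∘ₗ mulTensor C V)

noncomputable instance : Mul (GenShuffle C V) := ⟨fun a b => mulHom C V a b⟩
noncomputable instance : One (GenShuffle C V) := ⟨mk C V 1 1⟩

variable {C V}

lemma mul_def (a b : GenShuffle C V) : a * b = mulHom C V a b := rfl
lemma one_def : (1 : GenShuffle C V) = mk C V 1 1 := rfl

lemma mk_mul_mk (c d : C₂ C V) (f g : List V) :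
    mk C V c (word C f) * mk C V d (word C g) = (c * d) • mulWord C V f g := by
  rw [mul_def, mulHom, extend_mk, LinearMap.smul_apply, LinearMap.comp_apply, extend_mk,
    mulTensor, wordLift₂_word, smul_smul]

/-- The defining formula of the product on `C₂ ⊗ T`. -/
theorem mk_word_mul_mk_word (c d : C₂ C V) (f g : List V) :
    mk C V c (word C f) * mk C V d (word C g) =
      mk C V (c * d) (shuffle C f g) +
        ∑ i ∈ Finset.range f.length, ∑ j ∈ Finset.range g.length,
          mk C V (c * d * eps₂ C V (word C (f.drop i)) (word C (g.drop j)))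
            (shuffle C (f.take i) (g.take j)) := by
  simp only [mk_mul_mk, mulWord, smul_add, Finset.smul_sum, smul_mk, mul_one]

protected lemma add_mul (a b c : GenShuffle C V) : (a + b) * c = a * c + b * c := by
  simp only [mul_def, map_add, LinearMap.add_apply]
protected lemma mul_add (a b c : GenShuffle C V) : a * (b + c) = a * b + a * c := by
  simp only [mul_def, map_add]
protected lemma zero_mul (a : GenShuffle C V) : 0 * a = 0 := by
  simp only [mul_def, map_zero, LinearMap.zero_apply]
protected lemma mul_zero (a : GenShuffle C V) : a * 0 = 0 := by
  simp only [mul_def, map_zero]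
lemma smul₂_mul (c : C₂ C V) (a b : GenShuffle C V) : (c • a) * b = c • (a * b) := by
  simp only [mul_def, map_smul, LinearMap.smul_apply]
lemma mul_smul₂ (c : C₂ C V) (a b : GenShuffle C V) : a * (c • b) = c • (a * b) := by
  simp only [mul_def, map_smul]

protected lemma mul_comm (a b : GenShuffle C V) : a * b = b * a := by
  induction a using induction with
  | h0 => rw [GenShuffle.zero_mul, GenShuffle.mul_zero]
  | hadd x y hx hy => rw [GenShuffle.add_mul, GenShuffle.mul_add, hx, hy]
  | hmk c f =>
    induction b using induction with
    | h0 => rw [GenShuffle.zero_mul, GenShuffle.mul_zero]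
    | hadd x y hx hy => rw [GenShuffle.add_mul, GenShuffle.mul_add, hx, hy]
    | hmk d g => rw [mk_mul_mk, mk_mul_mk, mulWord_comm, mul_comm]

protected lemma one_mul (a : GenShuffle C V) : 1 * a = a := by
  induction a using induction with
  | h0 => rw [GenShuffle.mul_zero]
  | hadd x y hx hy => rw [GenShuffle.mul_add, hx, hy]
  | hmk d g => rw [one_def, ← word_nil, mk_mul_mk, mulWord_nil_left, smul_mk, one_mul, mul_one]

variable (C V) in
/-- The element `1 ⊗ f` for a pure tensor `f`. -/
noncomputable def W (f : List V) : GenShuffle C V := mk C V 1 (word C f)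

lemma W_mul_W (f g : List V) : W C V f * W C V g = mulWord C V f g := by
  rw [W, W, mk_mul_mk, one_mul, one_smul]

lemma W_nil : W C V ([] : List V) = 1 := rfl

lemma mk_word (c : C₂ C V) (f : List V) : mk C V c (word C f) = c • W C V f := by
  rw [W, smul_mk, mul_one]

variable (C V) in
/-- The `C₂`-bilinear extension of `eps₂` to `C₂ ⊗ T`. -/
noncomputable def eForm : GenShuffle C V →ₗ[C₂ C V] GenShuffle C V →ₗ[C₂ C V] C₂ C V :=
  extend C V (extend C V ∘ₗ eps₂ C V)

lemma eForm_mk (c d : C₂ C V) (s t : TensorAlgebra C V) :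
    eForm C V (mk C V c s) (mk C V d t) = c * (d * eps₂ C V s t) := by
  rw [eForm, extend_mk, LinearMap.smul_apply, LinearMap.comp_apply, extend_mk, smul_eq_mul,
    smul_eq_mul]

lemma eps₂_one_left (t : TensorAlgebra C V) : eps₂ C V 1 t = 0 := by
  rw [eps₂, LinearMap.compr₂_apply, epsSym_apply, posProj_one, TensorProduct.zero_tmul,
    Submodule.Quotient.mk_zero, map_zero, map_zero]

lemma eForm_comm (a b : GenShuffle C V) : eForm C V a b = eForm C V b a := by
  induction a using induction with
  | h0 => simp
  | hadd x y hx hy => simp [hx, hy]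
  | hmk c f =>
    induction b using induction with
    | h0 => simp
    | hadd x y hx hy => simp [hx, hy]
    | hmk d g => rw [eForm_mk, eForm_mk, eps₂_comm, mul_left_comm]

lemma eForm_one_left (a : GenShuffle C V) : eForm C V 1 a = 0 := by
  induction a using induction with
  | h0 => simp
  | hadd x y hx hy => simp [hx, hy]
  | hmk c f => rw [one_def, eForm_mk, eps₂_one_left, mul_zero, mul_zero]

lemma eForm_one_right (a : GenShuffle C V) : eForm C V a 1 = 0 := by
  rw [eForm_comm, eForm_one_left]

lemma cons_mul_cons (x y : V) (a b : GenShuffle C V) :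
    consL C V x a * consL C V y b = consL C V x (a * consL C V y b) +
      consL C V y (consL C V x a * b) + eForm C V (consL C V x a) (consL C V y b) • 1 := by
  induction a using induction with
  | h0 => simp [GenShuffle.zero_mul]
  | hadd s t hs ht =>
    simp only [map_add, GenShuffle.add_mul, hs, ht, LinearMap.add_apply, add_smul]
    abel
  | hmk c f =>
    induction b using induction with
    | h0 => simp [GenShuffle.mul_zero]
    | hadd s t hs ht =>
      simp only [map_add, GenShuffle.mul_add, hs, ht, add_smul]
      abel
    | hmk d g =>
      simp only [consL_mk, ← word_cons, mk_mul_mk, mulWord_cons_cons, smul_add, map_smul,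
        eForm_mk, one_def, smul_mk, mul_one, mul_assoc]

lemma sum_Ico_eq {N : Type*} [AddCommMonoid N] (φ : ℕ → N) (j n : ℕ) (h : j = 0 → φ 0 = 0) :
    ∑ i ∈ Finset.Ico (1 - j) n, φ i = ∑ i ∈ Finset.range n, φ i := by
  apply Finset.sum_subset
  · intro i hi
    simp only [Finset.mem_Ico, Finset.mem_range] at hi ⊢
    exact hi.2
  · intro i hi hi'
    simp only [Finset.mem_Ico, Finset.mem_range] at hi hi'
    obtain ⟨rfl, rfl⟩ : i = 0 ∧ j = 0 := by omega
    exact h rfl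

lemma eForm_mulWord (f g h : List V) : eForm C V (mulWord C V f g) (W C V h) =
    eps₂ C V (shuffle C f g) (word C h) +
      ∑ i ∈ Finset.range f.length, ∑ j ∈ Finset.range g.length,
        eps₂ C V (word C (f.drop i)) (word C (g.drop j)) *
          eps₂ C V (shuffle C (f.take i) (g.take j)) (word C h) := by
  simp only [mulWord, W, map_add, map_sum, LinearMap.add_apply, LinearMap.sum_apply, eForm_mk,
    one_mul]

lemma toC₂_epsSym (s t : TensorAlgebra C V) : toC₂ C V (epsSym C V s t) = eps₂ C V s t := rfl

/-- The relations of constants, in terms of `eForm`. -/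
lemma eForm_cocycle (x y z : V) (f g h : List V) :
    eForm C V (W C V (x :: f) * W C V (y :: g)) (W C V (z :: h)) =
      eForm C V (W C V (x :: f)) (W C V (y :: g) * W C V (z :: h)) := by
  have hrel : toC₂ C V (constRel C V (x :: f) (y :: g) (z :: h)) = 0 :=
    Ideal.Quotient.eq_zero_iff_mem.mpr
      (Ideal.subset_span ⟨_, _, _, List.cons_ne_nil _ _, List.cons_ne_nil _ _,
        List.cons_ne_nil _ _, rfl⟩)
  rw [W_mul_W, W_mul_W, eForm_comm (W C V (x :: f)), eForm_mulWord, eForm_mulWord]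
  generalize x :: f = f at *
  generalize y :: g = g at *
  generalize z :: h = h at *
  simp only [constRel, map_add, map_sub, map_sum, map_mul, toC₂_epsSym] at hrel
  have h1 : ∀ j, ∑ i ∈ Finset.Ico (1 - j) f.length,
      eps₂ C V (word C (f.drop i)) (word C (g.drop j)) *
        eps₂ C V (shuffle C (f.take i) (g.take j)) (word C h) =
      ∑ i ∈ Finset.range f.length, eps₂ C V (word C (f.drop i)) (word C (g.drop j)) *
        eps₂ C V (shuffle C (f.take i) (g.take j)) (word C h) := by
    intro j
    apply sum_Ico_eq
    rintro rfl
    simp [eps₂_one_left]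
  have h2 : ∀ j, ∑ k ∈ Finset.Ico (1 - j) h.length,
      eps₂ C V (word C f) (shuffle C (g.take j) (h.take k)) *
        eps₂ C V (word C (g.drop j)) (word C (h.drop k)) =
      ∑ k ∈ Finset.range h.length, eps₂ C V (word C f) (shuffle C (g.take j) (h.take k)) *
        eps₂ C V (word C (g.drop j)) (word C (h.drop k)) := by
    intro j
    apply sum_Ico_eq
    rintro rfl
    rw [eps₂_comm]
    simp [eps₂_one_left]
  simp only [h1, h2, Finset.sum_sub_distrib] at hrel
  rw [Finset.sum_comm, eps₂_comm (shuffle C g h)]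
  have h3 : ∀ j k, eps₂ C V (word C (g.drop j)) (word C (h.drop k)) *
      eps₂ C V (shuffle C (g.take j) (h.take k)) (word C f) =
      eps₂ C V (word C f) (shuffle C (g.take j) (h.take k)) *
        eps₂ C V (word C (g.drop j)) (word C (h.drop k)) := by
    intro j k
    rw [eps₂_comm (shuffle C _ _), mul_comm]
  simp only [h3]
  rw [← sub_eq_zero, ← hrel]
  abel

lemma cons_mul_cons_mul_cons (x y z : V) (a b c : GenShuffle C V) :
    (consL C V x a * consL C V y b) * consL C V z c =
      consL C V x ((a * consL C V y b) * consL C V z c) +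
        consL C V y ((consL C V x a * b) * consL C V z c) +
        consL C V z ((consL C V x a * consL C V y b) * c) +
        eForm C V (consL C V x a * consL C V y b) (consL C V z c) • 1 := by
  have h := cons_mul_cons x y a b
  set A := consL C V x a with hA
  set B := consL C V y b with hB
  rw [h]
  simp only [GenShuffle.add_mul, smul₂_mul, GenShuffle.one_mul, cons_mul_cons x z, cons_mul_cons y z,
    map_add, map_smul, LinearMap.add_apply, LinearMap.smul_apply, eForm_one_left, add_smul,
    smul_zero, zero_smul]
  abel

lemma cons_mul_cons_mul_cons_right (x y z : V) (a b c : GenShuffle C V) :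
    consL C V x a * (consL C V y b * consL C V z c) =
      consL C V x (a * (consL C V y b * consL C V z c)) +
        consL C V y (consL C V x a * (b * consL C V z c)) +
        consL C V z (consL C V x a * (consL C V y b * c)) +
        eForm C V (consL C V x a) (consL C V y b * consL C V z c) • 1 := by
  have h := cons_mul_cons_mul_cons z y x c b a
  have key : ∀ p q r : GenShuffle C V, (p * q) * r = r * (q * p) := fun p q r => by
    rw [GenShuffle.mul_comm, GenShuffle.mul_comm p]
  simp only [key] at h
  rw [h, eForm_comm, GenShuffle.mul_comm (consL C V z c)]
  abel

lemma W_cons (x : V) (f : List V) : W C V (x :: f) = consL C V x (W C V f) := by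
  rw [W, W, consL_mk, word_cons]

lemma W_assoc (f g h : List V) :
    (W C V f * W C V g) * W C V h = W C V f * (W C V g * W C V h) := by
  have mul_one : ∀ a : GenShuffle C V, a * 1 = a := fun a => by
    rw [GenShuffle.mul_comm, GenShuffle.one_mul]
  induction f generalizing g h with
  | nil => rw [W_nil, GenShuffle.one_mul, GenShuffle.one_mul]
  | cons x f ihf =>
    induction g generalizing h with
    | nil => rw [W_nil, mul_one, GenShuffle.one_mul]
    | cons y g ihg =>
      induction h with
      | nil => rw [W_nil, mul_one, mul_one]
      | cons z h ihh =>
        have hc := eForm_cocycle (C := C) x y z f g h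
        have ih1 := ihf (y :: g) (z :: h)
        have ih2 := ihg (z :: h)
        simp only [W_cons] at hc ih1 ih2 ihh ⊢
        rw [cons_mul_cons_mul_cons, cons_mul_cons_mul_cons_right, hc, ih1, ih2, ihh]

protected lemma mul_assoc (a b c : GenShuffle C V) : (a * b) * c = a * (b * c) := by
  induction a using induction with
  | h0 => simp only [GenShuffle.zero_mul]
  | hadd x y hx hy => simp only [GenShuffle.add_mul, hx, hy]
  | hmk r f =>
    induction b using induction with
    | h0 => simp only [GenShuffle.zero_mul, GenShuffle.mul_zero]
    | hadd x y hx hy => simp only [GenShuffle.add_mul, GenShuffle.mul_add, hx, hy]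
    | hmk s g =>
      induction c using induction with
      | h0 => simp only [GenShuffle.mul_zero]
      | hadd x y hx hy => simp only [GenShuffle.mul_add, hx, hy]
      | hmk t h => simp only [mk_word, smul₂_mul, mul_smul₂, W_assoc]

/-- The ring structure on `C₂ ⊗ T`. -/
noncomputable instance : CommRing (GenShuffle C V) :=
  { (inferInstance : AddCommGroup (GenShuffle C V)) with
    mul := fun a b => a * b
    one := 1
    left_distrib := GenShuffle.mul_add
    right_distrib := GenShuffle.add_mul
    zero_mul := GenShuffle.zero_mul
    mul_zero := GenShuffle.mul_zero
    mul_assoc := GenShuffle.mul_assoc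
    one_mul := GenShuffle.one_mul
    mul_one := fun a => by rw [GenShuffle.mul_comm, GenShuffle.one_mul]
    mul_comm := GenShuffle.mul_comm }

noncomputable instance : Algebra C (GenShuffle C V) :=
  Algebra.ofModule
    (fun r a b => by
      rw [← one_smul (C₂ C V) a, ← smul_assoc, smul₂_mul, smul₂_mul, smul_assoc])
    (fun r a b => by
      rw [← one_smul (C₂ C V) b, ← smul_assoc, mul_smul₂, mul_smul₂, smul_assoc])

end GenShuffle
end GeneralizedShuffle
section Differential

/-- The ring of constants of a derivation. -/
def constants {R : Type u} [CommRing R] (d : Derivation ℤ R R) : Subring R where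
  carrier := {c | d c = 0}
  mul_mem' := fun {a b} ha hb => by
    simp only [Set.mem_ofPred_eq] at ha hb ⊢
    simp [ha, hb]
  one_mem' := d.map_one_eq_zero
  add_mem' := fun {a b} ha hb => by
    simp only [Set.mem_ofPred_eq] at ha hb ⊢
    simp [ha, hb]
  zero_mem' := map_zero d
  neg_mem' := fun {a} ha => by
    simp only [Set.mem_ofPred_eq] at ha ⊢
    simp [ha]

/-- A commutative quasi-integro-differential ring: a commutative ring with a derivation `der`
and a quasi-integration `Q`, linear over the constants. -/
structure QuasiIntegroDifferentialRing (R : Type u) [CommRing R] where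
  der : Derivation ℤ R R
  Q : R →ₗ[constants der] R
  der_Q_der : ∀ f, der (Q (der f)) = der f
  Q_der_Q : ∀ f, Q (der (Q f)) = Q f

/-- `(A, δ, I)` is an integro-differential ring, for a commutative ring `A`: `δ` is a derivation
on `A` and `I` is an integration, i.e. a right inverse of `δ` that is linear over the constants. -/
structure IsIntegroDifferentialRing (A : Type*) [CommRing A] (δ I : A → A) : Prop where
  der_add : ∀ a b, δ (a + b) = δ a + δ b
  der_mul : ∀ a b, δ (a * b) = δ a * b + a * δ b
  der_int : ∀ a, δ (I a) = a
  int_add : ∀ a b, I (a + b) = I a + I b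
  int_const_mul : ∀ c a, δ c = 0 → I (c * a) = c * I a

/-- A ring homomorphism that respects derivations and integrations. -/
structure IsIntegroDifferentialHom {A B : Type*} [CommRing A] [CommRing B] (δA IA : A → A)
    (δB IB : B → B) (φ : A →+* B) : Prop where
  map_der : ∀ a, φ (δA a) = δB (φ a)
  map_int : ∀ a, φ (IA a) = IB (φ a)

/-- The integro-differential ideal generated by a set: the smallest ideal that contains it and is
closed under `δ` and `I`. -/
def integroDifferentialSpan {A : Type*} [CommRing A] (δ I : A → A) (S : Set A) : Ideal A :=
  sInf {J : Ideal A | S ⊆ J ∧ (∀ a ∈ J, δ a ∈ J) ∧ ∀ a ∈ J, I a ∈ J}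

lemma der_mem_integroDifferentialSpan {A : Type*} [CommRing A] (δ I : A → A) (S : Set A) :
    ∀ a ∈ integroDifferentialSpan δ I S, δ a ∈ integroDifferentialSpan δ I S := by
  intro a ha
  rw [integroDifferentialSpan, Submodule.mem_sInf] at ha ⊢
  exact fun J hJ => hJ.2.1 a (ha J hJ)

lemma int_mem_integroDifferentialSpan {A : Type*} [CommRing A] (δ I : A → A) (S : Set A) :
    ∀ a ∈ integroDifferentialSpan δ I S, I a ∈ integroDifferentialSpan δ I S := by
  intro a ha
  rw [integroDifferentialSpan, Submodule.mem_sInf] at ha ⊢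
  exact fun J hJ => hJ.2.2 a (ha J hJ)

/-- The map on a quotient ring induced by an additive map that preserves the ideal. -/
def quotMap {A : Type*} [CommRing A] (J : Ideal A) (φ : A →+ A) (h : ∀ a ∈ J, φ a ∈ J) :
    A ⧸ J → A ⧸ J :=
  Quotient.lift (fun a => Ideal.Quotient.mk J (φ a)) (fun a b hab => by
    refine Ideal.Quotient.eq.mpr ?_
    rw [← map_sub]
    exact h _ (Ideal.Quotient.eq.mp (Quotient.sound hab)))

@[simp] lemma quotMap_mk {A : Type*} [CommRing A] (J : Ideal A) (φ : A →+ A)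
    (h : ∀ a ∈ J, φ a ∈ J) (a : A) :
    quotMap J φ h (Ideal.Quotient.mk J a) = Ideal.Quotient.mk J (φ a) := rfl

end Differential

namespace QuasiIntegroDifferentialRing

variable {R : Type u} [CommRing R] (A : QuasiIntegroDifferentialRing R)

/-- The ring of constants of `R`. -/
abbrev Const : Type u := constants A.der

lemma der_smul (c : A.Const) (f : R) : A.der (c • f) = c • A.der f := by
  have hc : A.der (c : R) = 0 := c.2
  rw [Subring.smul_def, Subring.smul_def, smul_eq_mul, smul_eq_mul, Derivation.leibniz, hc]
  simp

/-- The image `Q R` of the quasi-integration. -/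
abbrev RJ : Submodule A.Const R := LinearMap.range A.Q

/-- The kernel of the quasi-integration, the module of non-integrable elements. -/
abbrev RT : Submodule A.Const R := LinearMap.ker A.Q

/-- The quasi-integration as a map to its image. -/
def toRJ : R →ₗ[A.Const] A.RJ := A.Q.rangeRestrict

/-- The projector `f ↦ f - ∂ Q f` onto the kernel of the quasi-integration. -/
def toRT : R →ₗ[A.Const] A.RT where
  toFun f := ⟨f - A.der (A.Q f), by rw [LinearMap.mem_ker, map_sub, A.Q_der_Q, sub_self]⟩
  map_add' f g := by
    apply Subtype.ext
    simp only [map_add, Submodule.coe_add]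
    abel
  map_smul' c f := by
    apply Subtype.ext
    simp only [map_smul, der_smul, RingHom.id_apply, Submodule.coe_smul, smul_sub]

@[simp] lemma coe_toRJ (f : R) : (A.toRJ f : R) = A.Q f := rfl
@[simp] lemma coe_toRT (f : R) : (A.toRT f : R) = f - A.der (A.Q f) := rfl

/-- The module `T` of tensors over the non-integrable elements. -/
abbrev T : Type u := TensorAlgebra A.Const A.RT

/-- The pure tensor in `T` given by a list. -/
noncomputable abbrev tensor (f : List A.RT) : A.T := word A.Const f

/-- The algebra `C₂ ⊗ T`. -/
abbrev C₂T : Type u := GenShuffle A.Const A.RT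

section Ext

variable (K : Type u) [CommRing K] [Algebra A.Const K]

/-- The tensor product of the algebras `R`, `K` and `C₂ ⊗ T`. -/
def Ext : Type u := R ⊗[A.Const] (K ⊗[A.Const] A.C₂T)

noncomputable instance : CommRing (A.Ext K) :=
  inferInstanceAs (CommRing (R ⊗[A.Const] (K ⊗[A.Const] A.C₂T)))
noncomputable instance : Algebra A.Const (A.Ext K) :=
  inferInstanceAs (Algebra A.Const (R ⊗[A.Const] (K ⊗[A.Const] A.C₂T)))

variable {K}

/-- The element `f₀ ⊗ c₁ ⊗ c₂ ⊗ t` of `R ⊗ K ⊗ C₂ ⊗ T`. -/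
noncomputable def tmul₄ (f₀ : R) (c₁ : K) (c₂ : C₂ A.Const A.RT) (t : A.T) : A.Ext K :=
  (f₀ ⊗ₜ[A.Const] (c₁ ⊗ₜ[A.Const] GenShuffle.mk A.Const A.RT c₂ t) :
    R ⊗[A.Const] (K ⊗[A.Const] A.C₂T))

variable (K) in
/-- The canonical map `f ↦ f ⊗ 1 ⊗ 1 ⊗ 1`. -/
noncomputable def extι : R →ₐ[A.Const] A.Ext K :=
  (Algebra.TensorProduct.includeLeft : R →ₐ[A.Const] R ⊗[A.Const] (K ⊗[A.Const] A.C₂T))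

theorem extι_apply (f : R) : A.extι K f = A.tmul₄ f 1 1 1 := rfl

/-- The product on `R ⊗ K ⊗ C₂ ⊗ T` is formed factor by factor in `R`, `K` and `C₂ ⊗ T`. -/
theorem tmul₄_mul_tmul₄ (a b : R) (c d : K) (c₂ d₂ : C₂ A.Const A.RT) (s t : A.T) :
    A.tmul₄ a c c₂ s * A.tmul₄ b d d₂ t =
      ((a * b) ⊗ₜ[A.Const] ((c * d) ⊗ₜ[A.Const]
        (GenShuffle.mk A.Const A.RT c₂ s * GenShuffle.mk A.Const A.RT d₂ t)) :
          R ⊗[A.Const] (K ⊗[A.Const] A.C₂T)) := by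
  refine (Algebra.TensorProduct.tmul_mul_tmul (R := A.Const) a b _ _).trans ?_
  rw [Algebra.TensorProduct.tmul_mul_tmul]

/-- A function of `f₀`, `c₁`, `c₂` and the factors of a pure tensor that is linear in each
argument. -/
structure ExtMultilinear {M : Type*} [AddCommGroup M] [Module A.Const M]
    (F : List A.RT → R → K → C₂ A.Const A.RT → M) : Prop where
  word : ∀ r k b, WordMultilinear A.Const fun l => F l r k b
  add₀ : ∀ l r r' k b, F l (r + r') k b = F l r k b + F l r' k b
  smul₀ : ∀ l (c : A.Const) r k b, F l (c • r) k b = c • F l r k b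
  add₁ : ∀ l r k k' b, F l r (k + k') b = F l r k b + F l r k' b
  smul₁ : ∀ l (c : A.Const) r k b, F l r (c • k) b = c • F l r k b
  add₂ : ∀ l r k b b', F l r k (b + b') = F l r k b + F l r k b'
  smul₂ : ∀ l (c : A.Const) r k b, F l r k (c • b) = c • F l r k b

section Lift

variable {M : Type*} [AddCommGroup M] [Module A.Const M]
variable (F : List A.RT → R → K → C₂ A.Const A.RT → M)

/-- The linear map on `R ⊗ (K ⊗ C₂)` given by a multilinear function and a fixed list. -/
noncomputable def extLiftAux (hF : A.ExtMultilinear F) (l : List A.RT) :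
    R ⊗[A.Const] (K ⊗[A.Const] C₂ A.Const A.RT) →ₗ[A.Const] M :=
  TensorProduct.lift
    { toFun := fun r => TensorProduct.lift (LinearMap.mk₂ A.Const (F l r)
        (fun k k' b => hF.add₁ l r k k' b) (fun c k b => hF.smul₁ l c r k b)
        (fun k b b' => hF.add₂ l r k b b') (fun c k b => hF.smul₂ l c r k b))
      map_add' := fun r r' => TensorProduct.ext' fun k b => by simp [hF.add₀]
      map_smul' := fun c r => TensorProduct.ext' fun k b => by simp [hF.smul₀] }

lemma extLiftAux_tmul (hF : A.ExtMultilinear F) (l : List A.RT) (r : R) (k : K)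
    (b : C₂ A.Const A.RT) :
    A.extLiftAux F hF l (r ⊗ₜ[A.Const] (k ⊗ₜ[A.Const] b)) = F l r k b := rfl

lemma ext_triple {f g : R ⊗[A.Const] (K ⊗[A.Const] C₂ A.Const A.RT) →ₗ[A.Const] M}
    (h : ∀ r k b, f (r ⊗ₜ[A.Const] (k ⊗ₜ[A.Const] b)) = g (r ⊗ₜ[A.Const] (k ⊗ₜ[A.Const] b))) :
    f = g := by
  refine TensorProduct.ext (LinearMap.ext fun r => ?_)
  refine TensorProduct.ext' fun k b => ?_
  exact h r k b

/-- The linear map on `R ⊗ K ⊗ C₂ ⊗ T` with prescribed values on pure tensors. -/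
noncomputable def extLift (hF : A.ExtMultilinear F) : A.Ext K →ₗ[A.Const] M :=
  TensorProduct.lift (wordLift (A.extLiftAux F hF)
    { add := fun a b x y => A.ext_triple fun r k c => by
        simp only [extLiftAux_tmul, LinearMap.add_apply, (hF.word r k c).add]
      smul := fun a b c x => A.ext_triple fun r k d => by
        simp only [extLiftAux_tmul, LinearMap.smul_apply, (hF.word r k d).smul] }).flip ∘ₗ
    (TensorProduct.assoc A.Const R (K ⊗[A.Const] C₂ A.Const A.RT) A.T).symm.toLinearMap ∘ₗ
    LinearMap.lTensor R
      (TensorProduct.assoc A.Const K (C₂ A.Const A.RT) A.T).symm.toLinearMap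

@[simp] lemma extLift_tmul₄ (hF : A.ExtMultilinear F) (f₀ : R) (c₁ : K) (c₂ : C₂ A.Const A.RT)
    (f : List A.RT) : A.extLift F hF (A.tmul₄ f₀ c₁ c₂ (A.tensor f)) = F f f₀ c₁ c₂ := by
  change (wordLift (A.extLiftAux F hF) _ : A.T →ₗ[A.Const] _) (A.tensor f) (f₀ ⊗ₜ[A.Const] (c₁ ⊗ₜ[A.Const] c₂)) = _
  rw [wordLift_word, extLiftAux_tmul]

end Lift

/-- The derivative of `f₀ ⊗ c₁ ⊗ c₂ ⊗ f` for a pure tensor `f`. -/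
noncomputable def derWord : List A.RT → R → K → C₂ A.Const A.RT → A.Ext K
  | [], f₀, c₁, c₂ => A.tmul₄ (A.der f₀) c₁ c₂ 1
  | f₁ :: f, f₀, c₁, c₂ =>
      A.tmul₄ (A.der f₀) c₁ c₂ (A.tensor (f₁ :: f)) + A.tmul₄ (f₀ * f₁) c₁ c₂ (A.tensor f)

/-- The integral of `f₀ ⊗ c₁ ⊗ c₂ ⊗ f` for a pure tensor `f`, where `ε` gives the constants
`ε(g ⊗ t)` in `K`. -/
noncomputable def intWord (ε : A.RJ →ₗ[A.Const] A.T →ₗ[A.Const] K) :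
    List A.RT → R → K → C₂ A.Const A.RT → A.Ext K
  | [], f₀, c₁, c₂ =>
      A.tmul₄ (A.Q f₀) c₁ c₂ 1 - A.tmul₄ 1 (c₁ * ε (A.toRJ f₀) 1) c₂ 1 +
        A.tmul₄ 1 c₁ c₂ (A.tensor [A.toRT f₀])
  | f₁ :: f, f₀, c₁, c₂ =>
      A.tmul₄ (A.Q f₀) c₁ c₂ (A.tensor (f₁ :: f)) -
        A.tmul₄ 1 (c₁ * ε (A.toRJ f₀) (A.tensor (f₁ :: f))) c₂ 1 -
        intWord ε f (A.Q f₀ * f₁) c₁ c₂ +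
        A.tmul₄ 1 c₁ c₂ (A.tensor (A.toRT f₀ :: f₁ :: f))

lemma tmul₄_add₀ (r r' : R) (k : K) (b : C₂ A.Const A.RT) (t : A.T) :
    A.tmul₄ (r + r') k b t = A.tmul₄ r k b t + A.tmul₄ r' k b t := TensorProduct.add_tmul _ _ _
lemma tmul₄_smul₀ (c : A.Const) (r : R) (k : K) (b : C₂ A.Const A.RT) (t : A.T) :
    A.tmul₄ (c • r) k b t = c • A.tmul₄ r k b t := (TensorProduct.smul_tmul' _ _ _).symm
lemma tmul₄_add₁ (r : R) (k k' : K) (b : C₂ A.Const A.RT) (t : A.T) :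
    A.tmul₄ r (k + k') b t = A.tmul₄ r k b t + A.tmul₄ r k' b t := by
  rw [tmul₄, TensorProduct.add_tmul, TensorProduct.tmul_add]; rfl
lemma tmul₄_smul₁ (c : A.Const) (r : R) (k : K) (b : C₂ A.Const A.RT) (t : A.T) :
    A.tmul₄ r (c • k) b t = c • A.tmul₄ r k b t := by
  rw [tmul₄, ← TensorProduct.smul_tmul', TensorProduct.tmul_smul]; rfl
lemma tmul₄_add₂ (r : R) (k : K) (b b' : C₂ A.Const A.RT) (t : A.T) :
    A.tmul₄ r k (b + b') t = A.tmul₄ r k b t + A.tmul₄ r k b' t := by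
  rw [tmul₄, map_add, LinearMap.add_apply, TensorProduct.tmul_add, TensorProduct.tmul_add]; rfl
lemma tmul₄_smul₂ (c : A.Const) (r : R) (k : K) (b : C₂ A.Const A.RT) (t : A.T) :
    A.tmul₄ r k (c • b) t = c • A.tmul₄ r k b t := by
  rw [tmul₄, map_smul, LinearMap.smul_apply, TensorProduct.tmul_smul, TensorProduct.tmul_smul]; rfl
lemma tmul₄_add₃ (r : R) (k : K) (b : C₂ A.Const A.RT) (t t' : A.T) :
    A.tmul₄ r k b (t + t') = A.tmul₄ r k b t + A.tmul₄ r k b t' := by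
  rw [tmul₄, map_add, TensorProduct.tmul_add, TensorProduct.tmul_add]; rfl
lemma tmul₄_smul₃ (c : A.Const) (r : R) (k : K) (b : C₂ A.Const A.RT) (t : A.T) :
    A.tmul₄ r k b (c • t) = c • A.tmul₄ r k b t := by
  rw [tmul₄, map_smul, TensorProduct.tmul_smul, TensorProduct.tmul_smul]; rfl

lemma word_multilinear : WordMultilinear A.Const (word A.Const : List A.RT → A.T) where
  add a b x y := by simp [word_append, add_mul, mul_add]
  smul a b c x := by simp [word_append]

lemma derWord_multilinear : A.ExtMultilinear (A.derWord (K := K)) where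
  word r k b :=
    { add := fun l m x y => by
        cases l with
        | nil =>
          simp only [List.nil_append, derWord, Submodule.coe_add, mul_add, tmul₄_add₀, word_cons,
            map_add, add_mul, tmul₄_add₃]
          abel
        | cons u l =>
          have h := A.word_multilinear.add (u :: l) m
          simp only [List.cons_append] at h
          simp only [List.cons_append, derWord, tensor, h, A.word_multilinear.add, tmul₄_add₃]
          abel
      smul := fun l m c x => by
        cases l with
        | nil =>
          simp only [List.nil_append, derWord, Submodule.coe_smul, mul_smul_comm, tmul₄_smul₀,
            word_cons, map_smul, smul_mul_assoc, tmul₄_smul₃, smul_add]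
        | cons u l =>
          have h := A.word_multilinear.smul (u :: l) m
          simp only [List.cons_append] at h
          simp only [List.cons_append, derWord, tensor, h, A.word_multilinear.smul, tmul₄_smul₃, smul_add] }
  add₀ l r r' k b := by
    cases l with
    | nil => simp only [derWord, map_add, tmul₄_add₀]
    | cons u l => simp only [derWord, map_add, add_mul, tmul₄_add₀]; abel
  smul₀ l c r k b := by
    cases l <;> simp only [derWord, der_smul, smul_mul_assoc, tmul₄_smul₀, smul_add]
  add₁ l r k k' b := by
    cases l with
    | nil => simp only [derWord, tmul₄_add₁]
    | cons u l => simp only [derWord, tmul₄_add₁]; abel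
  smul₁ l c r k b := by cases l <;> simp only [derWord, tmul₄_smul₁, smul_add]
  add₂ l r k b b' := by
    cases l with
    | nil => simp only [derWord, tmul₄_add₂]
    | cons u l => simp only [derWord, tmul₄_add₂]; abel
  smul₂ l c r k b := by cases l <;> simp only [derWord, tmul₄_smul₂, smul_add]

variable (ε : A.RJ →ₗ[A.Const] A.T →ₗ[A.Const] K)

lemma intWord_add₀ (l : List A.RT) (r r' : R) (k : K) (b : C₂ A.Const A.RT) :
    A.intWord ε l (r + r') k b = A.intWord ε l r k b + A.intWord ε l r' k b := by
  induction l generalizing r r' with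
  | nil =>
    simp only [intWord, map_add, LinearMap.add_apply, mul_add, tmul₄_add₀, tmul₄_add₁, word_cons,
      add_mul, tmul₄_add₃]
    abel
  | cons u l ih =>
    simp only [intWord, map_add, LinearMap.add_apply, mul_add, tmul₄_add₀, tmul₄_add₁, word_cons,
      add_mul, tmul₄_add₃, ih]
    abel

lemma intWord_smul₀ (l : List A.RT) (c : A.Const) (r : R) (k : K) (b : C₂ A.Const A.RT) :
    A.intWord ε l (c • r) k b = c • A.intWord ε l r k b := by
  induction l generalizing r with
  | nil =>
    simp only [intWord, map_smul, LinearMap.smul_apply, mul_smul_comm, tmul₄_smul₀, tmul₄_smul₁,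
      word_cons, smul_mul_assoc, tmul₄_smul₃, smul_add, smul_sub]
  | cons u l ih =>
    simp only [intWord, map_smul, LinearMap.smul_apply, mul_smul_comm, tmul₄_smul₀, tmul₄_smul₁,
      word_cons, smul_mul_assoc, tmul₄_smul₃, smul_add, smul_sub, ih]

lemma intWord_multilinear : A.ExtMultilinear (A.intWord ε) where
  word r k b :=
    { add := fun l m x y => by
        induction l generalizing r with
        | nil =>
          simp only [List.nil_append, intWord, Submodule.coe_add, mul_add, intWord_add₀,
            word_cons, map_add, add_mul, tmul₄_add₃, tmul₄_add₁]
          abel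
        | cons u l ih =>
          simp only [List.cons_append] at ih ⊢
          simp only [intWord, ih, tensor, word_cons, A.word_multilinear.add, map_add, mul_add,
            tmul₄_add₃, tmul₄_add₁]
          abel
      smul := fun l m c x => by
        induction l generalizing r with
        | nil =>
          simp only [List.nil_append, intWord, Submodule.coe_smul, mul_smul_comm, intWord_smul₀,
            word_cons, map_smul, smul_mul_assoc, tmul₄_smul₃, tmul₄_smul₁, smul_add, smul_sub]
        | cons u l ih =>
          simp only [List.cons_append] at ih ⊢
          simp only [intWord, ih, tensor, word_cons, A.word_multilinear.smul, map_smul,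
            mul_smul_comm, tmul₄_smul₃, tmul₄_smul₁, smul_add, smul_sub] }
  add₀ := A.intWord_add₀ ε
  smul₀ := A.intWord_smul₀ ε
  add₁ l r k k' b := by
    induction l generalizing r with
    | nil => simp only [intWord, tmul₄_add₁, add_mul]; abel
    | cons u l ih => simp only [intWord, tmul₄_add₁, add_mul, ih]; abel
  smul₁ l c r k b := by
    induction l generalizing r with
    | nil => simp only [intWord, tmul₄_smul₁, smul_mul_assoc, smul_add, smul_sub]
    | cons u l ih => simp only [intWord, tmul₄_smul₁, smul_mul_assoc, smul_add, smul_sub, ih]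
  add₂ l r k b b' := by
    induction l generalizing r with
    | nil => simp only [intWord, tmul₄_add₂]; abel
    | cons u l ih => simp only [intWord, tmul₄_add₂, ih]; abel
  smul₂ l c r k b := by
    induction l generalizing r with
    | nil => simp only [intWord, tmul₄_smul₂, smul_add, smul_sub]
    | cons u l ih => simp only [intWord, tmul₄_smul₂, smul_add, smul_sub, ih]

/-- The derivation on `R ⊗ K ⊗ C₂ ⊗ T`. -/
noncomputable def extDer : A.Ext K →ₗ[A.Const] A.Ext K := A.extLift A.derWord A.derWord_multilinear

/-- The integration on `R ⊗ K ⊗ C₂ ⊗ T`. -/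
noncomputable def extInt : A.Ext K →ₗ[A.Const] A.Ext K :=
  A.extLift (A.intWord ε) (A.intWord_multilinear ε)

theorem extDer_nil (f₀ : R) (c₁ : K) (c₂ : C₂ A.Const A.RT) :
    A.extDer (A.tmul₄ f₀ c₁ c₂ 1) = A.tmul₄ (A.der f₀) c₁ c₂ 1 :=
  A.extLift_tmul₄ A.derWord A.derWord_multilinear f₀ c₁ c₂ []

theorem extDer_cons (f₀ : R) (c₁ : K) (c₂ : C₂ A.Const A.RT) (f₁ : A.RT) (f : List A.RT) :
    A.extDer (A.tmul₄ f₀ c₁ c₂ (A.tensor (f₁ :: f))) =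
      A.tmul₄ (A.der f₀) c₁ c₂ (A.tensor (f₁ :: f)) + A.tmul₄ (f₀ * f₁) c₁ c₂ (A.tensor f) :=
  A.extLift_tmul₄ A.derWord A.derWord_multilinear f₀ c₁ c₂ (f₁ :: f)

theorem extInt_nil (f₀ : R) (c₁ : K) (c₂ : C₂ A.Const A.RT) :
    A.extInt ε (A.tmul₄ f₀ c₁ c₂ 1) =
      A.tmul₄ (A.Q f₀) c₁ c₂ 1 - A.tmul₄ 1 (c₁ * ε (A.toRJ f₀) 1) c₂ 1 +
        A.tmul₄ 1 c₁ c₂ (A.tensor [A.toRT f₀]) :=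
  A.extLift_tmul₄ _ (A.intWord_multilinear ε) f₀ c₁ c₂ []

theorem extInt_nil_of_eq_zero (hε : ∀ g, ε g 1 = 0) (f₀ : R) (c₁ : K) (c₂ : C₂ A.Const A.RT) :
    A.extInt ε (A.tmul₄ f₀ c₁ c₂ 1) =
      A.tmul₄ (A.Q f₀) c₁ c₂ 1 + A.tmul₄ 1 c₁ c₂ (A.tensor [A.toRT f₀]) := by
  have h1 : A.tmul₄ (1 : R) (0 : K) c₂ 1 = 0 := by
    rw [← zero_smul A.Const (0 : K), tmul₄_smul₁, zero_smul]
  rw [extInt_nil, hε, mul_zero, h1, sub_zero]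

theorem extInt_cons (f₀ : R) (c₁ : K) (c₂ : C₂ A.Const A.RT) (f₁ : A.RT) (f : List A.RT) :
    A.extInt ε (A.tmul₄ f₀ c₁ c₂ (A.tensor (f₁ :: f))) =
      A.tmul₄ (A.Q f₀) c₁ c₂ (A.tensor (f₁ :: f)) -
        A.tmul₄ 1 (c₁ * ε (A.toRJ f₀) (A.tensor (f₁ :: f))) c₂ 1 -
        A.extInt ε (A.tmul₄ (A.Q f₀ * f₁) c₁ c₂ (A.tensor f)) +
        A.tmul₄ 1 c₁ c₂ (A.tensor (A.toRT f₀ :: f₁ :: f)) := by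
  rw [extInt, extLift_tmul₄, extLift_tmul₄, intWord]

end Ext

/-! The free integro-differential ring on the differential ring `(R, ∂)`. -/

/-- The algebra `C₁ = Sym(R_J ⊗ T)`. -/
def C₁ : Type u := SymmetricAlgebra A.Const (A.RJ ⊗[A.Const] A.T)

noncomputable instance : CommRing A.C₁ :=
  inferInstanceAs (CommRing (SymmetricAlgebra A.Const (A.RJ ⊗[A.Const] A.T)))
noncomputable instance : Algebra A.Const A.C₁ :=
  inferInstanceAs (Algebra A.Const (SymmetricAlgebra A.Const (A.RJ ⊗[A.Const] A.T)))

/-- The canonical map from `R_J ⊗ T` to its symmetric algebra. -/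
noncomputable def ιC₁ : A.RJ ⊗[A.Const] A.T →ₗ[A.Const] A.C₁ := SymmetricAlgebra.ι A.Const _

/-- The constants `ε(g ⊗ t)` in `C₁`. -/
noncomputable def eps₁ : A.RJ →ₗ[A.Const] A.T →ₗ[A.Const] A.C₁ :=
  (TensorProduct.mk A.Const A.RJ A.T).compr₂ A.ιC₁

/-- The free commutative integro-differential ring `IDR(R) = R ⊗ C₁ ⊗ C₂ ⊗ T`. -/
abbrev IDR : Type u := A.Ext A.C₁

/-- The derivation on `IDR(R)`. -/
noncomputable def idrDer : A.IDR →ₗ[A.Const] A.IDR := A.extDer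

/-- The integration on `IDR(R)`. -/
noncomputable def idrInt : A.IDR →ₗ[A.Const] A.IDR := A.extInt A.eps₁

/-- The canonical map `f ↦ f ⊗ 1 ⊗ 1 ⊗ 1` from `R` to `IDR(R)`. -/
noncomputable def idrι : R →ₐ[A.Const] A.IDR := A.extι A.C₁

theorem idrDer_nil (f₀ : R) (c₁ : A.C₁) (c₂ : C₂ A.Const A.RT) :
    A.idrDer (A.tmul₄ f₀ c₁ c₂ 1) = A.tmul₄ (A.der f₀) c₁ c₂ 1 :=
  A.extDer_nil f₀ c₁ c₂

theorem idrDer_cons (f₀ : R) (c₁ : A.C₁) (c₂ : C₂ A.Const A.RT) (f₁ : A.RT) (f : List A.RT) :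
    A.idrDer (A.tmul₄ f₀ c₁ c₂ (A.tensor (f₁ :: f))) =
      A.tmul₄ (A.der f₀) c₁ c₂ (A.tensor (f₁ :: f)) + A.tmul₄ (f₀ * f₁) c₁ c₂ (A.tensor f) :=
  A.extDer_cons f₀ c₁ c₂ f₁ f

theorem idrInt_nil (f₀ : R) (c₁ : A.C₁) (c₂ : C₂ A.Const A.RT) :
    A.idrInt (A.tmul₄ f₀ c₁ c₂ 1) =
      A.tmul₄ (A.Q f₀) c₁ c₂ 1 - A.tmul₄ 1 (c₁ * A.eps₁ (A.toRJ f₀) 1) c₂ 1 +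
        A.tmul₄ 1 c₁ c₂ (A.tensor [A.toRT f₀]) :=
  A.extInt_nil A.eps₁ f₀ c₁ c₂

theorem idrInt_cons (f₀ : R) (c₁ : A.C₁) (c₂ : C₂ A.Const A.RT) (f₁ : A.RT) (f : List A.RT) :
    A.idrInt (A.tmul₄ f₀ c₁ c₂ (A.tensor (f₁ :: f))) =
      A.tmul₄ (A.Q f₀) c₁ c₂ (A.tensor (f₁ :: f)) -
        A.tmul₄ 1 (c₁ * A.eps₁ (A.toRJ f₀) (A.tensor (f₁ :: f))) c₂ 1 -
        A.idrInt (A.tmul₄ (A.Q f₀ * f₁) c₁ c₂ (A.tensor f)) +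
        A.tmul₄ 1 c₁ c₂ (A.tensor (A.toRT f₀ :: f₁ :: f)) :=
  A.extInt_cons A.eps₁ f₀ c₁ c₂ f₁ f

/-! The construction that respects the quasi-integration `Q`. -/

/-- The module `T̃` of tensors of positive degree. -/
noncomputable abbrev PosT : Submodule A.Const A.T := PosTensor A.Const A.RT

/-- The algebra `C̃₁ = Sym(R_J ⊗ T̃)`. -/
def C₁Q : Type u := SymmetricAlgebra A.Const (A.RJ ⊗[A.Const] A.PosT)

noncomputable instance : CommRing A.C₁Q :=
  inferInstanceAs (CommRing (SymmetricAlgebra A.Const (A.RJ ⊗[A.Const] A.PosT)))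
noncomputable instance : Algebra A.Const A.C₁Q :=
  inferInstanceAs (Algebra A.Const (SymmetricAlgebra A.Const (A.RJ ⊗[A.Const] A.PosT)))

/-- The canonical map from `R_J ⊗ T̃` to its symmetric algebra. -/
noncomputable def ιC₁Q : A.RJ ⊗[A.Const] A.PosT →ₗ[A.Const] A.C₁Q := SymmetricAlgebra.ι A.Const _

/-- The constants `ε(g ⊗ t)` in `C̃₁`, with `ε(g ⊗ 1) = 0` for the empty tensor. -/
noncomputable def eps₁Q : A.RJ →ₗ[A.Const] A.T →ₗ[A.Const] A.C₁Q :=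
  ((TensorProduct.mk A.Const A.RJ A.PosT).compl₂ (posProj A.Const A.RT)).compr₂ A.ιC₁Q

lemma eps₁Q_one (g : A.RJ) : A.eps₁Q g 1 = 0 := by
  rw [eps₁Q, LinearMap.compr₂_apply, LinearMap.compl₂_apply, posProj_one, map_zero, map_zero]

/-- The algebra `IDR_Q(R) = R ⊗ C̃₁ ⊗ C₂ ⊗ T`. -/
abbrev IDRQ : Type u := A.Ext A.C₁Q

/-- The derivation on `IDR_Q(R)`. -/
noncomputable def idrQDer : A.IDRQ →ₗ[A.Const] A.IDRQ := A.extDer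

/-- The integration on `IDR_Q(R)`. -/
noncomputable def idrQInt : A.IDRQ →ₗ[A.Const] A.IDRQ := A.extInt A.eps₁Q

/-- The canonical map `f ↦ f ⊗ 1 ⊗ 1 ⊗ 1` from `R` to `IDR_Q(R)`. -/
noncomputable def idrQι : R →ₐ[A.Const] A.IDRQ := A.extι A.C₁Q

theorem idrQDer_nil (f₀ : R) (c₁ : A.C₁Q) (c₂ : C₂ A.Const A.RT) :
    A.idrQDer (A.tmul₄ f₀ c₁ c₂ 1) = A.tmul₄ (A.der f₀) c₁ c₂ 1 :=
  A.extDer_nil f₀ c₁ c₂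

theorem idrQDer_cons (f₀ : R) (c₁ : A.C₁Q) (c₂ : C₂ A.Const A.RT) (f₁ : A.RT) (f : List A.RT) :
    A.idrQDer (A.tmul₄ f₀ c₁ c₂ (A.tensor (f₁ :: f))) =
      A.tmul₄ (A.der f₀) c₁ c₂ (A.tensor (f₁ :: f)) + A.tmul₄ (f₀ * f₁) c₁ c₂ (A.tensor f) :=
  A.extDer_cons f₀ c₁ c₂ f₁ f

theorem idrQInt_nil (f₀ : R) (c₁ : A.C₁Q) (c₂ : C₂ A.Const A.RT) :
    A.idrQInt (A.tmul₄ f₀ c₁ c₂ 1) =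
      A.tmul₄ (A.Q f₀) c₁ c₂ 1 + A.tmul₄ 1 c₁ c₂ (A.tensor [A.toRT f₀]) :=
  A.extInt_nil_of_eq_zero A.eps₁Q A.eps₁Q_one f₀ c₁ c₂

theorem idrQInt_cons (f₀ : R) (c₁ : A.C₁Q) (c₂ : C₂ A.Const A.RT) (f₁ : A.RT) (f : List A.RT) :
    A.idrQInt (A.tmul₄ f₀ c₁ c₂ (A.tensor (f₁ :: f))) =
      A.tmul₄ (A.Q f₀) c₁ c₂ (A.tensor (f₁ :: f)) -
        A.tmul₄ 1 (c₁ * A.eps₁Q (A.toRJ f₀) (A.tensor (f₁ :: f))) c₂ 1 -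
        A.idrQInt (A.tmul₄ (A.Q f₀ * f₁) c₁ c₂ (A.tensor f)) +
        A.tmul₄ 1 c₁ c₂ (A.tensor (A.toRT f₀ :: f₁ :: f)) :=
  A.extInt_cons A.eps₁Q f₀ c₁ c₂ f₁ f

/-- The integro-differential ideal of `IDR(R)` generated by the constants
`1 ⊗ ε(Q ∂ f) ⊗ 1 ⊗ 1` with `f` in `R`. -/
noncomputable def J₁ : Ideal A.IDR :=
  integroDifferentialSpan A.idrDer A.idrInt
    {x | ∃ f : R, x = A.tmul₄ 1 (A.eps₁ (A.toRJ (A.der f)) 1) 1 1}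

/-- The derivation induced on `IDR(R) / J₁`. -/
noncomputable def quotDer : A.IDR ⧸ A.J₁ → A.IDR ⧸ A.J₁ :=
  quotMap A.J₁ A.idrDer.toAddMonoidHom (der_mem_integroDifferentialSpan _ _ _)

/-- The integration induced on `IDR(R) / J₁`. -/
noncomputable def quotInt : A.IDR ⧸ A.J₁ → A.IDR ⧸ A.J₁ :=
  quotMap A.J₁ A.idrInt.toAddMonoidHom (int_mem_integroDifferentialSpan _ _ _)

end QuasiIntegroDifferentialRing

end IDRing

namespace IDRing

/-! ### Calculus in `C₂ ⊗ T`: constants and leading letters. -/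

namespace GenShuffle

variable {C : Type u} {V : Type v} [CommRing C] [AddCommGroup V] [Module C V]

/-! Both rings are instances of one construction: for every commutative `C`-algebra `K` and every
bilinear `ε : R_J × T → K`, the algebra `R ⊗ K ⊗ C₂ ⊗ T` is an integro-differential ring
(`ext_isIntegroDifferentialRing`). `IDR(R)` has `K = C₁`; `IDR_Q(R)` has `K = C̃₁` and `ε(g ⊗ 1) =
0`.

The Leibniz rule rests on `GenShuffle.cons_mul_cons`: a product of two nonempty tensors is the sum
of the two ways of pulling out a leading letter, plus an element of `C₂` times `1`. Since `∂` strips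
the leading letter and ignores `C₂`, this recursion is the product rule (`extDer_mul`). That `∂∫ =
id` is a telescoping induction on the length of the tensor. For linearity over constants, `a - ∫∂a`
always lies in the span of the elements `1 ⊗ c₁ ⊗ c₂ ⊗ 1` (`sub_extInt_extDer_mem`), so every
constant does, and such factors pass through the recursion defining `∫` (`extInt_const_mul`).

The map from `R` is injective because the augmentations of `C̃₁`, `C₂` and `T` give a linear
retraction (`extι_injective`). On `∂R` the formula for `∫` in `IDR_Q(R)` reduces to `Q`, because `f₀
- ∂Qf₀` vanishes for `f₀` in `∂R`.

The map `C₁ → C̃₁` killing all `ε(g ⊗ 1)` induces a surjection `IDR(R) → IDR_Q(R)` compatible with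
both operations, whose kernel contains `J₁`. Conversely `Q = Q∂Q` puts every `ε(g ⊗ 1)` in `J₁`, so
modulo `J₁` the inclusion `C̃₁ → C₁` supplies the inverse (`mk_extMap_idrToIDRQ`). Uniqueness
follows because `R` generates `IDR(R)` under the ring operations and `∫`
(`mem_of_ι_mem_of_int_mem`): all new constants can be solved for in products of integrals and in the
formula for `∫`. -/

lemma mk_one (c : C₂ C V) : mk C V c 1 = c • (1 : GenShuffle C V) := by
  rw [one_def, smul_mk, mul_one]

lemma mk_word_cons (c : C₂ C V) (x : V) (l : List V) :
    mk C V c (word C (x :: l)) = consL C V x (mk C V c (word C l)) := by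
  rw [consL_mk, word_cons]

lemma smul_one_mul (c : C₂ C V) (w : GenShuffle C V) : (c • (1 : GenShuffle C V)) * w = c • w := by
  rw [smul₂_mul, one_mul]

lemma mk_one_mul_mk (c d : C₂ C V) (t : TensorAlgebra C V) :
    mk C V c 1 * mk C V d t = mk C V (c * d) t := by
  rw [mk_one, smul_one_mul, smul_mk]

/-- Every element of `C₂ ⊗ T` is a sum of elements `c ⊗ 1` and `x ⊗ w`. -/
lemma cons_induction {p : GenShuffle C V → Prop} (x : GenShuffle C V) (h0 : p 0)
    (hnil : ∀ c : C₂ C V, p (c • 1)) (hcons : ∀ x w, p (consL C V x w))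
    (hadd : ∀ x y, p x → p y → p (x + y)) : p x := by
  induction x using induction with
  | h0 => exact h0
  | hadd a b ha hb => exact hadd a b ha hb
  | hmk c l =>
    cases l with
    | nil => rw [word_nil, mk_one]; exact hnil c
    | cons x l => rw [mk_word_cons]; exact hcons _ _

end GenShuffle

/-- The augmentation of `C₂`, which sends all the generators to `0`. -/
noncomputable def augC₂ (C : Type u) (V : Type v) [CommRing C] [AddCommGroup V] [Module C V] :
    C₂ C V →ₐ[C] C :=
  Ideal.Quotient.liftₐ (relIdeal C V) SymmetricAlgebra.algebraMapInv (by
    have h : relIdeal C V ≤ RingHom.ker (SymmetricAlgebra.algebraMapInv (R := C)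
        (M := SymSq C (PosTensor C V))) := by
      rw [relIdeal, Ideal.span_le]
      rintro _ ⟨f, g, h, -, -, -, rfl⟩
      -- Every summand of `constRel` has a generator as a factor, and the augmentation kills
      -- generators.
      simp [constRel, epsSym_apply, SymmetricAlgebra.algebraMapInv_ι]
    exact fun a ha => h ha)

namespace QuasiIntegroDifferentialRing

variable {R : Type u} [CommRing R] (A : QuasiIntegroDifferentialRing R)

/-! ### The integro-differential ring `R ⊗ K ⊗ C₂ ⊗ T` for arbitrary `K`. -/

section Ext

variable {K : Type u} [CommRing K] [Algebra A.Const K]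

/-- The element `f₀ ⊗ c₁ ⊗ w` of `R ⊗ K ⊗ (C₂ ⊗ T)`. -/
noncomputable def tmul₃ (r : R) (k : K) (w : A.C₂T) : A.Ext K :=
  (r ⊗ₜ[A.Const] (k ⊗ₜ[A.Const] w) : R ⊗[A.Const] (K ⊗[A.Const] A.C₂T))

lemma tmul₄_eq (r : R) (k : K) (c : C₂ A.Const A.RT) (t : A.T) :
    A.tmul₄ r k c t = A.tmul₃ r k (GenShuffle.mk A.Const A.RT c t) := rfl

lemma tmul₃_mul (r s : R) (k l : K) (v w : A.C₂T) :
    A.tmul₃ r k v * A.tmul₃ s l w = A.tmul₃ (r * s) (k * l) (v * w) := by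
  refine (Algebra.TensorProduct.tmul_mul_tmul (R := A.Const) r s _ _).trans ?_
  rw [Algebra.TensorProduct.tmul_mul_tmul]; rfl

lemma tmul₃_add₀ (r s : R) (k : K) (w : A.C₂T) :
    A.tmul₃ (r + s) k w = A.tmul₃ r k w + A.tmul₃ s k w := TensorProduct.add_tmul _ _ _

lemma tmul₃_add₂ (r : R) (k : K) (v w : A.C₂T) :
    A.tmul₃ r k (v + w) = A.tmul₃ r k v + A.tmul₃ r k w := by
  rw [tmul₃, TensorProduct.tmul_add, TensorProduct.tmul_add]; rfl

lemma tmul₃_zero₀ (k : K) (w : A.C₂T) : A.tmul₃ 0 k w = 0 := TensorProduct.zero_tmul _ _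

lemma tmul₃_zero₁ (r : R) (w : A.C₂T) : A.tmul₃ r (0 : K) w = 0 := by
  rw [tmul₃, TensorProduct.zero_tmul, TensorProduct.tmul_zero]; rfl

lemma tmul₃_zero₂ (r : R) (k : K) : A.tmul₃ r k 0 = 0 := by
  rw [tmul₃, TensorProduct.tmul_zero, TensorProduct.tmul_zero]; rfl

variable {A} in
lemma tmul₃_induction {p : A.Ext K → Prop} (a : A.Ext K) (h0 : p 0)
    (htmul : ∀ r k w, p (A.tmul₃ r k w)) (hadd : ∀ a b, p a → p b → p (a + b)) : p a := by
  refine TensorProduct.induction_on (motive := p) a h0 (fun r y => ?_) hadd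
  induction y using TensorProduct.induction_on with
  | zero => rw [TensorProduct.tmul_zero]; exact h0
  | tmul k w => exact htmul r k w
  | add y z hy hz => rw [TensorProduct.tmul_add]; exact hadd _ _ hy hz

variable {A} in
-- The derivation distinguishes only empty from nonempty tensors. Leaving the tail `w` arbitrary,
-- rather than a pure tensor, is what lets `cons_mul_cons` be applied to products.
lemma cons_induction {p : A.Ext K → Prop} (a : A.Ext K) (h0 : p 0)
    (hnil : ∀ r k (c : C₂ A.Const A.RT), p (A.tmul₃ r k (c • 1)))
    (hcons : ∀ r k x w, p (A.tmul₃ r k (GenShuffle.consL A.Const A.RT x w)))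
    (hadd : ∀ a b, p a → p b → p (a + b)) : p a := by
  induction a using tmul₃_induction with
  | h0 => exact h0
  | hadd a b ha hb => exact hadd a b ha hb
  | htmul r k w =>
    induction w using GenShuffle.cons_induction with
    | h0 => rw [tmul₃_zero₂]; exact h0
    | hnil c => exact hnil r k c
    | hcons x w => exact hcons r k x w
    | hadd v w hv hw => rw [tmul₃_add₂]; exact hadd _ _ hv hw

variable {A} in
lemma tmul₄_induction {p : A.Ext K → Prop} (a : A.Ext K) (h0 : p 0)
    (htmul : ∀ r k c l, p (A.tmul₄ r k c (A.tensor l)))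
    (hadd : ∀ a b, p a → p b → p (a + b)) : p a := by
  induction a using tmul₃_induction with
  | h0 => exact h0
  | hadd a b ha hb => exact hadd a b ha hb
  | htmul r k w =>
    induction w using GenShuffle.induction with
    | h0 => rw [tmul₃_zero₂]; exact h0
    | hmk c l => exact htmul r k c l
    | hadd v w hv hw => rw [tmul₃_add₂]; exact hadd _ _ hv hw

/-! The derivation. -/

lemma extDer_smul_one (r : R) (k : K) (c : C₂ A.Const A.RT) :
    A.extDer (A.tmul₃ r k (c • 1)) = A.tmul₃ (A.der r) k (c • 1) := by
  rw [← GenShuffle.mk_one]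
  exact A.extDer_nil r k c

lemma extDer_consL (r : R) (k : K) (x : A.RT) (w : A.C₂T) :
    A.extDer (A.tmul₃ r k (GenShuffle.consL A.Const A.RT x w)) =
      A.tmul₃ (A.der r) k (GenShuffle.consL A.Const A.RT x w) + A.tmul₃ (r * x) k w := by
  induction w using GenShuffle.induction with
  | h0 => simp only [map_zero, tmul₃_zero₂, add_zero]
  | hadd v w hv hw => simp only [map_add, tmul₃_add₂, hv, hw]; abel
  | hmk c l =>
    rw [← GenShuffle.mk_word_cons]
    exact A.extDer_cons r k c x l

/-- The Leibniz rule when one factor has an empty tensor: multiplication by it only scales the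
tensor of the other factor, so no shuffling occurs. -/
lemma extDer_smul_one_mul (r s : R) (k l : K) (c : C₂ A.Const A.RT) (w : A.C₂T) :
    A.extDer (A.tmul₃ r k (c • 1) * A.tmul₃ s l w) =
      A.extDer (A.tmul₃ r k (c • 1)) * A.tmul₃ s l w +
        A.tmul₃ r k (c • 1) * A.extDer (A.tmul₃ s l w) := by
  induction w using GenShuffle.cons_induction with
  | h0 => simp only [tmul₃_zero₂, mul_zero, map_zero, add_zero]
  | hadd v w hv hw => simp only [tmul₃_add₂, mul_add, map_add, hv, hw]; abel
  | hnil d =>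
    simp only [tmul₃_mul, GenShuffle.smul_one_mul, smul_smul, extDer_smul_one,
      Derivation.leibniz, smul_eq_mul, tmul₃_add₀, mul_comm s]
    abel
  | hcons y w =>
    simp only [extDer_consL, mul_add, tmul₃_mul, extDer_smul_one, GenShuffle.smul_one_mul,
      ← map_smul, Derivation.leibniz, smul_eq_mul, tmul₃_add₀, mul_comm s, mul_assoc]
    abel

lemma extDer_mul (a b : A.Ext K) :
    A.extDer (a * b) = A.extDer a * b + a * A.extDer b := by
  induction a using cons_induction with
  | h0 => simp only [zero_mul, map_zero, add_zero]
  | hadd a a' ha ha' => simp only [add_mul, map_add, ha, ha']; abel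
  | hnil r k c =>
    induction b using tmul₃_induction with
    | h0 => simp only [mul_zero, map_zero, add_zero]
    | hadd b b' hb hb' => simp only [mul_add, map_add, hb, hb']; abel
    | htmul s l w => exact A.extDer_smul_one_mul r s k l c w
  | hcons r k x v =>
    induction b using cons_induction with
    | h0 => simp only [mul_zero, map_zero, add_zero]
    | hadd b b' hb hb' => simp only [mul_add, map_add, hb, hb']; abel
    | hnil s l c =>
      -- Here the second factor has the empty tensor; commutativity exchanges the roles.
      have h := A.extDer_smul_one_mul s r l k c (GenShuffle.consL A.Const A.RT x v)
      rw [mul_comm, h]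
      ring
    | hcons s l y w =>
      -- Stripping `x` or `y` from the product multiplies `r * s` by that letter. These identities
      -- assign the letter to the factor it came from; the `eForm` term contributes only through
      -- `∂(r * s)`.
      have h1 : r * s * (x : R) = r * x * s := by ring
      have h2 : r * s * (y : R) = r * (s * y) := by ring
      simp only [extDer_consL, tmul₃_mul, GenShuffle.cons_mul_cons, add_mul, mul_add, tmul₃_add₀,
        tmul₃_add₂, map_add, extDer_smul_one, Derivation.leibniz, smul_eq_mul, h1, h2,
        mul_comm s]
      abel

/-! The integration. -/

variable (ε : A.RJ →ₗ[A.Const] A.T →ₗ[A.Const] K)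

lemma extDer_extInt (a : A.Ext K) : A.extDer (A.extInt ε a) = a := by
  induction a using tmul₄_induction with
  | h0 => rw [map_zero, map_zero]
  | hadd a b ha hb => rw [map_add, map_add, ha, hb]
  | htmul r k c l =>
    have hz : ∀ k c (t : A.T), A.tmul₄ (0 : R) (k : K) c t = 0 := fun _ _ _ => tmul₃_zero₀ _ _ _
    induction l generalizing r with
    | nil =>
      rw [tensor, word_nil, extInt_nil, map_add, map_sub, extDer_nil, extDer_nil, extDer_cons,
        A.der.map_one_eq_zero, hz, hz, one_mul, coe_toRT, tensor, word_nil, zero_add, sub_zero,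
        ← tmul₄_add₀, add_sub_cancel]
    | cons u l ih =>
      -- The letter `u` stripped from `Qr ⊗ (u ⊗ l)` leaves `(Qr)u ⊗ l`, which the induction
      -- hypothesis cancels against the derivative of the inner integral. What remains is `∂Qr + (r
      -- - ∂Qr) = r` in the first factor.
      rw [extInt_cons, map_add, map_sub, map_sub, ih, extDer_cons, extDer_nil, extDer_cons,
        A.der.map_one_eq_zero, hz, hz, one_mul, coe_toRT, zero_add, sub_zero, add_sub_cancel_right,
        ← tmul₄_add₀, add_sub_cancel]

/-- An element of `R_T` has `Qx = 0`, so only the last term of the integration formula survives.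
Thus nonempty pure tensors really are nested integrals, which is used both for the constants and for
generation. -/
lemma extInt_coe_RT (x : A.RT) (k : K) (w : A.C₂T) :
    A.extInt ε (A.tmul₃ x k w) = A.tmul₃ 1 k (GenShuffle.consL A.Const A.RT x w) := by
  have hQ : A.Q x = 0 := x.2
  have hJ : A.toRJ x = 0 := Subtype.ext hQ
  have hT : A.toRT x = x := Subtype.ext (by rw [coe_toRT, hQ, map_zero, sub_zero])
  have hz : ∀ k c (t : A.T), A.tmul₄ (0 : R) (k : K) c t = 0 := fun _ _ _ => tmul₃_zero₀ _ _ _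
  have hz₁ : ∀ r c (t : A.T), A.tmul₄ (r : R) (0 : K) c t = 0 := fun _ _ _ => tmul₃_zero₁ _ _ _
  induction w using GenShuffle.induction with
  | h0 => simp only [map_zero, tmul₃_zero₂]
  | hadd v w hv hw => simp only [map_add, tmul₃_add₂, hv, hw]
  | hmk c l =>
    rw [← GenShuffle.mk_word_cons, ← tmul₄_eq, ← tmul₄_eq]
    cases l with
    | nil =>
      rw [word_nil, extInt_nil, hQ, hJ, hT, map_zero, LinearMap.zero_apply, mul_zero, hz, hz₁]
      abel
    | cons u l =>
      rw [extInt_cons, hQ, hJ, hT, map_zero, LinearMap.zero_apply, mul_zero, hz, hz₁, zero_mul, hz,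
        map_zero]
      abel

lemma tmul₄_one_one_mul (r : R) (k k' : K) (c c' : C₂ A.Const A.RT) (t : A.T) :
    A.tmul₄ 1 k c 1 * A.tmul₄ r k' c' t = A.tmul₄ r (k * k') (c * c') t := by
  rw [tmul₄_eq, tmul₄_eq, tmul₃_mul, GenShuffle.mk_one_mul_mk, one_mul, tmul₄_eq]

/-- The factors `c₁` and `c₂` enter every term of the recursion for `∫` multiplicatively and never
interact with the tensor. -/
lemma extInt_tmul₄_one_one_mul (k : K) (c : C₂ A.Const A.RT) (a : A.Ext K) :
    A.extInt ε (A.tmul₄ 1 k c 1 * a) = A.tmul₄ 1 k c 1 * A.extInt ε a := by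
  induction a using tmul₄_induction with
  | h0 => simp only [mul_zero, map_zero]
  | hadd a b ha hb => simp only [mul_add, map_add, ha, hb]
  | htmul r k' c' l =>
    induction l generalizing r with
    | nil =>
      simp only [tensor, word_nil, tmul₄_one_one_mul, extInt_nil, mul_add, mul_sub, mul_assoc]
    | cons u l ih =>
      rw [tmul₄_one_one_mul, extInt_cons, extInt_cons, mul_add, mul_sub, mul_sub, ← ih]
      simp only [tmul₄_one_one_mul, mul_assoc]

variable (K) in
/-- The module generated by the elements `1 ⊗ c₁ ⊗ c₂ ⊗ 1`. -/
noncomputable def constSpan : Submodule A.Const (A.Ext K) :=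
  Submodule.span A.Const {a | ∃ k c, a = A.tmul₄ 1 k c 1}

lemma tmul₄_mem_constSpan (k : K) (c : C₂ A.Const A.RT) : A.tmul₄ 1 k c 1 ∈ A.constSpan K :=
  Submodule.subset_span ⟨k, c, rfl⟩

lemma extInt_const_mul {c : A.Ext K} (hc : c ∈ A.constSpan K) (a : A.Ext K) :
    A.extInt ε (c * a) = c * A.extInt ε a := by
  induction hc using Submodule.span_induction with
  | mem c h => obtain ⟨k, d, rfl⟩ := h; exact A.extInt_tmul₄_one_one_mul ε k d a
  | zero => simp only [zero_mul, map_zero]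
  | add c d _ _ hc hd => simp only [add_mul, map_add, hc, hd]
  | smul r c _ hc => simp only [smul_mul_assoc, map_smul, hc]

lemma der_sub_Q_der (r : R) : A.der (r - A.Q (A.der r)) = 0 := by
  rw [map_sub, A.der_Q_der, sub_self]

lemma toRT_der (r : R) : A.toRT (A.der r) = 0 :=
  Subtype.ext (by rw [coe_toRT, A.der_Q_der, sub_self]; rfl)

/-- This replaces a direct computation of `ker ∂`: if `∂a = 0` then `a` itself lies in `constSpan`.
For a nonempty tensor the difference is exactly the `ε` term of the integration formula; for the
empty one a multiple of `1 ⊗ c₁ ⊗ c₂ ⊗ 1` by a constant of `R` is added. -/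
lemma sub_extInt_extDer_mem (a : A.Ext K) : a - A.extInt ε (A.extDer a) ∈ A.constSpan K := by
  induction a using tmul₄_induction with
  | h0 => simp only [map_zero, sub_zero, Submodule.zero_mem]
  | hadd a b ha hb =>
    rw [map_add, map_add, add_sub_add_comm]
    exact add_mem ha hb
  | htmul r k c l =>
    -- `∂Q∂ = ∂` makes `r - Q∂r` a constant of `R`, so it can be moved out as a scalar.
    let e : A.Const := ⟨r - A.Q (A.der r), A.der_sub_Q_der r⟩
    have hr : r = A.Q (A.der r) + (e : R) := (add_sub_cancel _ _).symm
    cases l with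
    | nil =>
      have hz : A.tmul₄ 1 k c (A.tensor [(0 : A.RT)]) = 0 := by
        rw [tensor, word_cons, map_zero, zero_mul, tmul₄_eq, map_zero, tmul₃_zero₂]
      have he1 : A.tmul₄ (e : R) k c 1 = e • A.tmul₄ 1 k c 1 := by
        rw [← tmul₄_smul₀, Subring.smul_def, smul_eq_mul, mul_one]
      have h : A.tmul₄ r k c 1 = A.tmul₄ (A.Q (A.der r)) k c 1 + e • A.tmul₄ 1 k c 1 := by
        rw [← he1, ← tmul₄_add₀, ← hr]
      rw [tensor, word_nil, extDer_nil, extInt_nil, toRT_der, hz, h, add_zero,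
        show ∀ a b c : A.Ext K, a + b - (a - c) = b + c from fun a b c => by abel]
      exact add_mem (Submodule.smul_mem _ _ (A.tmul₄_mem_constSpan k c))
        (A.tmul₄_mem_constSpan _ _)
    | cons u l =>
      have hz : A.tmul₄ 1 k c (A.tensor (0 :: u :: l)) = 0 := by
        rw [tensor, word_cons, map_zero, zero_mul, tmul₄_eq, map_zero, tmul₃_zero₂]
      have h1 : A.tmul₄ (r * u) k c (A.tensor l) =
          A.tmul₄ (A.Q (A.der r) * u) k c (A.tensor l) + e • A.tmul₄ u k c (A.tensor l) := by
        rw [← tmul₄_smul₀, Subring.smul_def, smul_eq_mul, ← tmul₄_add₀, ← add_mul, ← hr]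
      have h2 : A.tmul₄ r k c (A.tensor (u :: l)) =
          A.tmul₄ (A.Q (A.der r)) k c (A.tensor (u :: l)) +
            e • A.tmul₄ 1 k c (A.tensor (u :: l)) := by
        rw [← tmul₄_smul₀, Subring.smul_def, smul_eq_mul, mul_one, ← tmul₄_add₀, ← hr]
      -- The part of `∫(ru ⊗ l)` with coefficient `e` integrates back to the `e` part of `r ⊗ (u ⊗
      -- l)`; the part with `Q∂r` cancels the inner integral in the expansion of `∫(∂r ⊗ (u ⊗ l))`.
      have h3 : A.extInt ε (A.tmul₄ u k c (A.tensor l)) = A.tmul₄ 1 k c (A.tensor (u :: l)) := by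
        rw [tmul₄_eq, extInt_coe_RT, ← GenShuffle.mk_word_cons, ← tmul₄_eq]
      rw [extDer_cons, map_add, extInt_cons, toRT_der, hz, h1, map_add, map_smul, h3, h2, add_zero,
        show ∀ a b c d : A.Ext K, a + b - (a - c - d + (d + b)) = c from
          fun a b c d => by abel]
      exact A.tmul₄_mem_constSpan _ _

theorem ext_isIntegroDifferentialRing :
    IsIntegroDifferentialRing (A.Ext K) A.extDer (A.extInt ε) where
  der_add := map_add _
  der_mul := A.extDer_mul
  der_int := A.extDer_extInt ε
  int_add := map_add _
  int_const_mul c a hc := by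
    have h := A.sub_extInt_extDer_mem ε c
    rw [hc, map_zero, sub_zero] at h
    exact A.extInt_const_mul ε h a

/-- Some hypothesis on `K` is needed, since `K` could be zero. A homomorphism `K → C` combines with
the augmentations of `C₂` and `T` into a `C`-linear left inverse. -/
lemma extι_injective (φ : K →ₐ[A.Const] A.Const) : Function.Injective (A.extι K) := by
  -- Only linearity and the value at `1` matter: `ψ` is not claimed to respect the twisted product
  -- of `C₂ ⊗ T`.
  let ψ : A.C₂T →ₗ[A.Const] A.Const :=
    TensorProduct.lift ((LinearMap.mul A.Const A.Const).compl₁₂ (augC₂ A.Const A.RT).toLinearMap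
      (TensorAlgebra.algebraMapInv (R := A.Const) (M := A.RT)).toLinearMap)
  have hψ : ψ 1 = 1 := by
    change augC₂ A.Const A.RT 1 * TensorAlgebra.algebraMapInv (1 : A.T) = 1
    rw [map_one, map_one, one_mul]
  let ρ : A.Ext K →ₗ[A.Const] R :=
    TensorProduct.lift ((LinearMap.lsmul A.Const R).flip.compl₂
      (TensorProduct.lift ((LinearMap.mul A.Const A.Const).compl₁₂ φ.toLinearMap ψ)))
  refine Function.LeftInverse.injective (g := ρ) fun r => ?_
  change (φ 1 * ψ 1) • r = r
  rw [hψ, map_one, one_mul, one_smul]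

end Ext

end QuasiIntegroDifferentialRing

lemma posProj_coe {C : Type u} {V : Type v} [CommRing C] [AddCommGroup V] [Module C V]
    (t : PosTensor C V) : posProj C V (t : TensorAlgebra C V) = t := by
  have h : TensorAlgebra.algebraMapInv (t : TensorAlgebra C V) = 0 := t.2
  refine Subtype.ext ?_
  rw [coe_posProj, h, map_zero, sub_zero]

lemma C₂_induction {C : Type u} {V : Type v} [CommRing C] [AddCommGroup V] [Module C V]
    {p : C₂ C V → Prop} (c : C₂ C V) (halg : ∀ r, p (algebraMap C (C₂ C V) r))
    (heps : ∀ s t, p (eps₂ C V s t)) (hmul : ∀ a b, p a → p b → p (a * b))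
    (hadd : ∀ a b, p a → p b → p (a + b)) : p c := by
  obtain ⟨s, rfl⟩ : ∃ s, toC₂ C V s = c := Ideal.Quotient.mk_surjective c
  induction s using SymmetricAlgebra.induction with
  | algebraMap r => rw [AlgHom.commutes]; exact halg r
  | ι x =>
    obtain ⟨y, rfl⟩ := Submodule.Quotient.mk_surjective _ x
    induction y using TensorProduct.induction_on with
    | zero => simpa only [Submodule.Quotient.mk_zero, map_zero] using halg 0
    | add y z hy hz => rw [Submodule.Quotient.mk_add, map_add, map_add]; exact hadd _ _ hy hz
    | tmul f g =>
      -- Generators of the symmetric algebra come from positive tensors, whereas `eps₂` takes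
      -- arbitrary ones and projects; `posProj_coe` identifies the two here.
      have h := heps (f : TensorAlgebra C V) (g : TensorAlgebra C V)
      rwa [← GenShuffle.toC₂_epsSym, epsSym_apply, posProj_coe, posProj_coe] at h
  | mul a b ha hb => rw [map_mul]; exact hmul _ _ ha hb
  | add a b ha hb => rw [map_add]; exact hadd _ _ ha hb

namespace QuasiIntegroDifferentialRing

variable {R : Type u} [CommRing R] (A : QuasiIntegroDifferentialRing R)

/-! ### Functoriality of the construction in `K`. -/

section ExtMap

variable {K L : Type u} [CommRing K] [Algebra A.Const K] [CommRing L] [Algebra A.Const L]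

/-- The homomorphism `R ⊗ K ⊗ C₂ ⊗ T → R ⊗ L ⊗ C₂ ⊗ T` induced by a homomorphism `K → L`. -/
noncomputable def extMap (φ : K →ₐ[A.Const] L) : A.Ext K →ₐ[A.Const] A.Ext L :=
  (Algebra.TensorProduct.map (AlgHom.id A.Const R)
    (Algebra.TensorProduct.map φ (AlgHom.id A.Const A.C₂T)) :
      R ⊗[A.Const] (K ⊗[A.Const] A.C₂T) →ₐ[A.Const] R ⊗[A.Const] (L ⊗[A.Const] A.C₂T))

lemma extMap_tmul₄ (φ : K →ₐ[A.Const] L) (r : R) (k : K) (c : C₂ A.Const A.RT) (t : A.T) :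
    A.extMap φ (A.tmul₄ r k c t) = A.tmul₄ r (φ k) c t := rfl

lemma extMap_extι (φ : K →ₐ[A.Const] L) (r : R) : A.extMap φ (A.extι K r) = A.extι L r := by
  rw [extι_apply, extι_apply, extMap_tmul₄, map_one]

lemma extMap_extDer (φ : K →ₐ[A.Const] L) (a : A.Ext K) :
    A.extMap φ (A.extDer a) = A.extDer (A.extMap φ a) := by
  induction a using tmul₄_induction with
  | h0 => simp only [map_zero]
  | hadd a b ha hb => simp only [map_add, ha, hb]
  | htmul r k c l =>
    cases l with
    | nil => simp only [tensor, word_nil, extMap_tmul₄, extDer_nil]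
    | cons x l => rw [extDer_cons, map_add, extMap_tmul₄, extMap_tmul₄, extMap_tmul₄, extDer_cons]

/-- The integrations depend on `K` only through the constants `ε(g ⊗ t)`, so matching these is
enough. -/
lemma extMap_extInt (φ : K →ₐ[A.Const] L) (ε : A.RJ →ₗ[A.Const] A.T →ₗ[A.Const] K)
    (ε' : A.RJ →ₗ[A.Const] A.T →ₗ[A.Const] L) (h : ∀ g t, φ (ε g t) = ε' g t) (a : A.Ext K) :
    A.extMap φ (A.extInt ε a) = A.extInt ε' (A.extMap φ a) := by
  induction a using tmul₄_induction with
  | h0 => simp only [map_zero]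
  | hadd a b ha hb => simp only [map_add, ha, hb]
  | htmul r k c l =>
    induction l generalizing r with
    | nil =>
      simp only [tensor, word_nil, extMap_tmul₄, extInt_nil, map_add, map_sub, map_mul, h]
    | cons x l ih =>
      simp only [extInt_cons, map_add, map_sub, ih, extMap_tmul₄, map_mul, h]

end ExtMap

variable {A} in
lemma C₁_induction {p : A.C₁ → Prop} (k : A.C₁) (halg : ∀ r, p (algebraMap A.Const A.C₁ r))
    (heps : ∀ g t, p (A.eps₁ g t)) (hmul : ∀ a b, p a → p b → p (a * b))
    (hadd : ∀ a b, p a → p b → p (a + b)) : p k := by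
  refine SymmetricAlgebra.induction (R := A.Const) (M := A.RJ ⊗[A.Const] A.T) (motive := p)
    halg (fun x => ?_) hmul hadd k
  change p (A.ιC₁ x)
  induction x using TensorProduct.induction_on with
  | zero => simpa only [map_zero] using halg 0
  | tmul g t => exact heps g t
  | add y z hy hz => rw [map_add]; exact hadd _ _ hy hz

/-! Generation of `IDR(R)` by `R`. -/

lemma extι_mul_tmul₃ {K : Type u} [CommRing K] [Algebra A.Const K] (r s : R) (k : K)
    (w : A.C₂T) : A.extι K r * A.tmul₃ s k w = A.tmul₃ (r * s) k w := by
  have h : A.extι K r = A.tmul₃ r 1 1 := rfl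
  rw [h, tmul₃_mul, one_mul, one_mul]

section Generation

variable {A}
variable {S : Subring A.IDR} (hι : ∀ r, A.idrι r ∈ S) (hint : ∀ a ∈ S, A.idrInt a ∈ S)
include hι

/-- Scalars from `C` are themselves images of elements of `R`, so a subring containing the image of
`R` is automatically a `C`-submodule. -/
lemma smul_mem_of_ι_mem (c : A.Const) {a : A.IDR} (ha : a ∈ S) : c • a ∈ S := by
  rw [Algebra.smul_def, ← AlgHom.commutes A.idrι]
  exact S.mul_mem (hι _) ha

include hint

lemma tmul₃_consL_mem (x : A.RT) {w : A.C₂T} (hw : A.tmul₃ 1 (1 : A.C₁) w ∈ S) :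
    A.tmul₃ 1 (1 : A.C₁) (GenShuffle.consL A.Const A.RT x w) ∈ S := by
  rw [← A.extInt_coe_RT A.eps₁]
  refine hint _ ?_
  have h := S.mul_mem (hι x) hw
  rwa [idrι, extι_mul_tmul₃, mul_one] at h

lemma tmul₃_W_mem (l : List A.RT) :
    A.tmul₃ 1 (1 : A.C₁) (GenShuffle.W A.Const A.RT l) ∈ S := by
  induction l with
  | nil => exact S.one_mem
  | cons x l ih => rw [GenShuffle.W_cons]; exact tmul₃_consL_mem hι hint x ih

lemma tmul₄_eps₂_mem (s t : A.T) :
    A.tmul₄ 1 (1 : A.C₁) (eps₂ A.Const A.RT s t) 1 ∈ S := by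
  have hs : s ∈ Submodule.span A.Const (Set.range (word A.Const : List A.RT → A.T)) := by
    rw [span_words]; trivial
  have ht : t ∈ Submodule.span A.Const (Set.range (word A.Const : List A.RT → A.T)) := by
    rw [span_words]; trivial
  -- Covers the zero tensors and the empty words, on which `eps₂` vanishes.
  have hz : A.tmul₄ 1 (1 : A.C₁) 0 1 ∈ S := by
    rw [tmul₄_eq, map_zero, LinearMap.zero_apply, tmul₃_zero₂]; exact S.zero_mem
  induction hs using Submodule.span_induction with
  | zero => rwa [map_zero, LinearMap.zero_apply]
  | add a b _ _ ha hb => rw [map_add, LinearMap.add_apply, tmul₄_add₂]; exact S.add_mem ha hb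
  | smul c a _ ha =>
    rw [map_smul, LinearMap.smul_apply, tmul₄_smul₂]; exact smul_mem_of_ι_mem hι c ha
  | mem _ h =>
    obtain ⟨f, rfl⟩ := h
    induction ht using Submodule.span_induction with
    | zero => rwa [map_zero]
    | add a b _ _ ha hb => rw [map_add, tmul₄_add₂]; exact S.add_mem ha hb
    | smul c a _ ha => rw [map_smul, tmul₄_smul₂]; exact smul_mem_of_ι_mem hι c ha
    | mem _ h =>
      obtain ⟨g, rfl⟩ := h
      cases f with
      | nil => rwa [word_nil, GenShuffle.eps₂_one_left]
      | cons x f =>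
        cases g with
        | nil => rwa [word_nil, GenShuffle.eps₂_comm, GenShuffle.eps₂_one_left]
        | cons y g =>
          have hf := tmul₃_W_mem hι hint f
          have hg := tmul₃_W_mem hι hint g
          have hxf := tmul₃_W_mem hι hint (x :: f)
          have hyg := tmul₃_W_mem hι hint (y :: g)
          have h1 := tmul₃_consL_mem hι hint x
            (by simpa only [tmul₃_mul, mul_one] using S.mul_mem hf hyg)
          have h2 := tmul₃_consL_mem hι hint y
            (by simpa only [tmul₃_mul, mul_one] using S.mul_mem hxf hg)
          -- In the product of two nonempty words, both shuffle terms are obtained by prepending a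
          -- letter and so lie in `S`. Subtracting them isolates the constant `ε(f ⊙ g)`.
          have h := S.sub_mem (S.sub_mem (S.mul_mem hxf hyg) h1) h2
          rw [tmul₃_mul, GenShuffle.W_mul_W, GenShuffle.mulWord_cons_cons, ← GenShuffle.W_mul_W,
            ← GenShuffle.W_mul_W, tmul₃_add₂, tmul₃_add₂, mul_one, mul_one, add_assoc,
            add_sub_cancel_left, add_sub_cancel_left] at h
          exact h

lemma tmul₄_C₂_mem (c : C₂ A.Const A.RT) : A.tmul₄ 1 (1 : A.C₁) c 1 ∈ S := by
  induction c using C₂_induction with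
  | halg r =>
    rw [Algebra.algebraMap_eq_smul_one, tmul₄_smul₂]
    exact smul_mem_of_ι_mem hι r S.one_mem
  | heps s t => exact tmul₄_eps₂_mem hι hint s t
  | hmul a b ha hb =>
    rw [← mul_one (1 : A.C₁), ← tmul₄_one_one_mul]
    exact S.mul_mem ha hb
  | hadd a b ha hb =>
    rw [tmul₄_add₂]
    exact S.add_mem ha hb

/-- Every `g` in `R_J` is some `Qr`, and the formula for `∫(r ⊗ t)` can be solved for `ε(Qr ⊗ t)`:
all its other terms are products of elements of `R` and words, or integrals of such products. -/
lemma tmul₄_eps₁_mem (g : A.RJ) (t : A.T) : A.tmul₄ 1 (A.eps₁ g t) 1 1 ∈ S := by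
  obtain ⟨r, rfl⟩ : ∃ r, A.toRJ r = g := A.Q.surjective_rangeRestrict g
  have ht : t ∈ Submodule.span A.Const (Set.range (word A.Const : List A.RT → A.T)) := by
    rw [span_words]; trivial
  have hι' : ∀ r l, A.tmul₄ r (1 : A.C₁) 1 (A.tensor l) ∈ S := fun r l => by
    have h := S.mul_mem (hι r) (tmul₃_W_mem hι hint l)
    rwa [idrι, extι_mul_tmul₃, mul_one] at h
  induction ht using Submodule.span_induction with
  | zero => rw [map_zero, tmul₄_eq, tmul₃_zero₁]; exact S.zero_mem
  | add a b _ _ ha hb => rw [map_add, tmul₄_add₁]; exact S.add_mem ha hb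
  | smul c a _ ha => rw [map_smul, tmul₄_smul₁]; exact smul_mem_of_ι_mem hι c ha
  | mem _ h =>
    obtain ⟨l, rfl⟩ := h
    cases l with
    | nil =>
      have h := A.idrInt_nil r 1 1
      rw [one_mul, ← word_nil] at h
      have h' : A.tmul₄ 1 (A.eps₁ (A.toRJ r) (A.tensor [])) 1 (A.tensor []) =
          A.tmul₄ (A.Q r) 1 1 (A.tensor []) + A.tmul₄ 1 1 1 (A.tensor [A.toRT r]) -
            A.idrInt (A.tmul₄ r 1 1 (A.tensor [])) := by rw [tensor, h]; abel
      change A.tmul₄ 1 (A.eps₁ (A.toRJ r) (A.tensor [])) 1 (A.tensor []) ∈ S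
      rw [h']
      exact S.sub_mem (S.add_mem (hι' _ _) (hι' _ _)) (hint _ (hι' _ _))
    | cons x l =>
      have h := A.idrInt_cons r 1 1 x l
      rw [one_mul] at h
      have h' : A.tmul₄ 1 (A.eps₁ (A.toRJ r) (A.tensor (x :: l))) 1 1 =
          A.tmul₄ (A.Q r) 1 1 (A.tensor (x :: l)) - A.idrInt (A.tmul₄ (A.Q r * x) 1 1 (A.tensor l)) +
            A.tmul₄ 1 1 1 (A.tensor (A.toRT r :: x :: l)) -
            A.idrInt (A.tmul₄ r 1 1 (A.tensor (x :: l))) := by rw [h]; abel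
      rw [h']
      exact S.sub_mem (S.add_mem (S.sub_mem (hι' _ _) (hint _ (hι' _ _))) (hι' _ _))
        (hint _ (hι' _ _))

lemma tmul₄_C₁_mem (k : A.C₁) : A.tmul₄ 1 k 1 1 ∈ S := by
  induction k using C₁_induction with
  | halg r =>
    rw [Algebra.algebraMap_eq_smul_one, tmul₄_smul₁]
    exact smul_mem_of_ι_mem hι r S.one_mem
  | heps g t => exact tmul₄_eps₁_mem hι hint g t
  | hmul a b ha hb =>
    have h := S.mul_mem ha hb
    rwa [tmul₄_one_one_mul, one_mul] at h
  | hadd a b ha hb =>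
    rw [tmul₄_add₁]
    exact S.add_mem ha hb

/-- `IDR(R)` is generated by `R` as a ring with integration. -/
theorem mem_of_ι_mem_of_int_mem (a : A.IDR) : a ∈ S := by
  induction a using tmul₄_induction with
  | h0 => exact S.zero_mem
  | hadd a b ha hb => exact S.add_mem ha hb
  | htmul r k c l =>
    have h := S.mul_mem (S.mul_mem (hι r) (S.mul_mem (tmul₄_C₁_mem hι hint k)
      (tmul₄_C₂_mem hι hint c))) (tmul₃_W_mem hι hint l)
    rwa [tmul₄_one_one_mul, mul_one, one_mul, tmul₄_eq, idrι, extι_mul_tmul₃, tmul₃_mul,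
      GenShuffle.mk_one, GenShuffle.smul_one_mul, ← GenShuffle.mk_word, mul_one, mul_one,
      mul_one, ← tmul₄_eq] at h

end Generation

/-! The comparison of `IDR(R)` and `IDR_Q(R)`. -/

/-- The homomorphism `C₁ → C̃₁` that sends the constants `ε(g)` to `0`. -/
noncomputable def C₁toC₁Q : A.C₁ →ₐ[A.Const] A.C₁Q :=
  (SymmetricAlgebra.lift (TensorProduct.lift A.eps₁Q) :
    SymmetricAlgebra A.Const (A.RJ ⊗[A.Const] A.T) →ₐ[A.Const] A.C₁Q)

lemma C₁toC₁Q_eps₁ (g : A.RJ) (t : A.T) : A.C₁toC₁Q (A.eps₁ g t) = A.eps₁Q g t :=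
  (SymmetricAlgebra.lift_ι_apply _ _).trans (TensorProduct.lift.tmul _ _)

/-- The inclusion `C̃₁ → C₁`. -/
noncomputable def C₁QtoC₁ : A.C₁Q →ₐ[A.Const] A.C₁ :=
  (SymmetricAlgebra.lift (TensorProduct.lift (A.eps₁.compl₂ A.PosT.subtype)) :
    SymmetricAlgebra A.Const (A.RJ ⊗[A.Const] A.PosT) →ₐ[A.Const] A.C₁)

lemma C₁QtoC₁_eps₁Q (g : A.RJ) (t : A.T) :
    A.C₁QtoC₁ (A.eps₁Q g t) = A.eps₁ g (posProj A.Const A.RT t) :=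
  (SymmetricAlgebra.lift_ι_apply _ _).trans (TensorProduct.lift.tmul _ _)

lemma C₁_algHom_ext {B : Type*} [CommRing B] [Algebra A.Const B] {φ φ' : A.C₁ →ₐ[A.Const] B}
    (h : ∀ g t, φ (A.eps₁ g t) = φ' (A.eps₁ g t)) : φ = φ' := by
  refine SymmetricAlgebra.algHom_ext (R := A.Const) (M := A.RJ ⊗[A.Const] A.T) ?_
  exact TensorProduct.ext' h

lemma C₁toC₁Q_comp_C₁QtoC₁ : A.C₁toC₁Q.comp A.C₁QtoC₁ = AlgHom.id A.Const A.C₁Q := by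
  refine SymmetricAlgebra.algHom_ext (R := A.Const) (M := A.RJ ⊗[A.Const] A.PosT)
    (TensorProduct.ext' fun g t => ?_)
  -- Rewriting the generator through `eps₁Q` loses nothing, because `t` is already of positive
  -- degree.
  have h : A.ιC₁Q (g ⊗ₜ t) = A.eps₁Q g t := by
    rw [eps₁Q, LinearMap.compr₂_apply, LinearMap.compl₂_apply, posProj_coe]; rfl
  change A.C₁toC₁Q (A.C₁QtoC₁ (A.ιC₁Q (g ⊗ₜ t))) = A.ιC₁Q (g ⊗ₜ t)
  rw [h, C₁QtoC₁_eps₁Q, C₁toC₁Q_eps₁, posProj_coe]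

variable (K : Type u) [CommRing K] [Algebra A.Const K] in
/-- The inclusion of `K` into `R ⊗ K ⊗ C₂ ⊗ T`. -/
noncomputable def extK : K →ₐ[A.Const] A.Ext K :=
  ((Algebra.TensorProduct.includeRight).comp Algebra.TensorProduct.includeLeft :
    K →ₐ[A.Const] R ⊗[A.Const] (K ⊗[A.Const] A.C₂T))

/-- The homomorphism `IDR(R) → IDR_Q(R)`. -/
noncomputable def idrToIDRQ : A.IDR →ₐ[A.Const] A.IDRQ := A.extMap A.C₁toC₁Q

lemma idrToIDRQ_der (a : A.IDR) : A.idrToIDRQ (A.idrDer a) = A.idrQDer (A.idrToIDRQ a) :=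
  A.extMap_extDer _ a

lemma idrToIDRQ_int (a : A.IDR) : A.idrToIDRQ (A.idrInt a) = A.idrQInt (A.idrToIDRQ a) :=
  A.extMap_extInt _ _ _ A.C₁toC₁Q_eps₁ a

lemma idrToIDRQ_surjective : Function.Surjective A.idrToIDRQ := by
  intro a
  refine ⟨A.extMap A.C₁QtoC₁ a, ?_⟩
  induction a using tmul₄_induction with
  | h0 => simp only [map_zero]
  | hadd a b ha hb => simp only [map_add, ha, hb]
  | htmul r k c l =>
    rw [idrToIDRQ, extMap_tmul₄, extMap_tmul₄, ← AlgHom.comp_apply, C₁toC₁Q_comp_C₁QtoC₁]; rfl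

/-- The kernel of a homomorphism commuting with `∂` and `∫` is an integro-differential ideal, so
only the generators need checking; they go to `0` because `ε(g ⊗ 1) = 0` in `C̃₁`. -/
lemma J₁_le_ker : ∀ a ∈ A.J₁, A.idrToIDRQ a = 0 := by
  intro a ha
  rw [J₁, integroDifferentialSpan, Submodule.mem_sInf] at ha
  refine ha (RingHom.ker A.idrToIDRQ) ⟨?_, fun b hb => ?_, fun b hb => ?_⟩
  · rintro _ ⟨f, rfl⟩
    change A.idrToIDRQ _ = 0
    rw [idrToIDRQ, extMap_tmul₄, C₁toC₁Q_eps₁, eps₁Q_one, tmul₄_eq, tmul₃_zero₁]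
  · rw [RingHom.mem_ker] at hb ⊢
    rw [idrToIDRQ_der, hb, map_zero]
  · rw [RingHom.mem_ker] at hb ⊢
    rw [idrToIDRQ_int, hb, map_zero]

/-- The generators of `J₁` involve only `Q∂f`, but `Q = Q∂Q` shows that these exhaust `R_J`. -/
lemma tmul₄_eps₁_one_mem_J₁ (g : A.RJ) : A.tmul₄ 1 (A.eps₁ g 1) 1 1 ∈ A.J₁ := by
  obtain ⟨r, rfl⟩ : ∃ r, A.toRJ r = g := A.Q.surjective_rangeRestrict g
  have h : A.toRJ r = A.toRJ (A.der (A.Q r)) := Subtype.ext (A.Q_der_Q r).symm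
  rw [h, J₁, integroDifferentialSpan, Submodule.mem_sInf]
  exact fun J hJ => hJ.1 ⟨_, rfl⟩

lemma mk_tmul₄_C₁ (k : A.C₁) :
    Ideal.Quotient.mk A.J₁ (A.tmul₄ 1 (A.C₁QtoC₁ (A.C₁toC₁Q k)) 1 1) =
      Ideal.Quotient.mk A.J₁ (A.tmul₄ 1 k 1 1) := by
  have h : ((Ideal.Quotient.mkₐ A.Const A.J₁).comp (A.extK A.C₁)).comp
      (A.C₁QtoC₁.comp A.C₁toC₁Q) = (Ideal.Quotient.mkₐ A.Const A.J₁).comp (A.extK A.C₁) := by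
    refine A.C₁_algHom_ext fun g t => ?_
    simp only [AlgHom.comp_apply, C₁toC₁Q_eps₁, C₁QtoC₁_eps₁Q, Ideal.Quotient.mkₐ_eq_mk]
    -- The composite replaces `t` by its positive part. The error is minus the degree-zero
    -- coefficient of `t` times `ε(g ⊗ 1)`.
    rw [Ideal.Quotient.eq, ← map_sub, ← map_sub, coe_posProj, sub_sub_cancel_left,
      Algebra.algebraMap_eq_smul_one, map_neg, map_smul, map_neg, map_smul, Algebra.smul_def]
    exact neg_mem (Ideal.mul_mem_left _ _ (A.tmul₄_eps₁_one_mem_J₁ g))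
  exact DFunLike.congr_fun h k

/-- This gives injectivity on the quotient. The maps alter only the factor in `C₁`, which can be
split off as `1 ⊗ k ⊗ 1 ⊗ 1`, so `mk_tmul₄_C₁` suffices. -/
lemma mk_extMap_idrToIDRQ (a : A.IDR) :
    Ideal.Quotient.mk A.J₁ (A.extMap A.C₁QtoC₁ (A.idrToIDRQ a)) = Ideal.Quotient.mk A.J₁ a := by
  induction a using tmul₄_induction with
  | h0 => simp only [map_zero]
  | hadd a b ha hb => simp only [map_add, ha, hb]
  | htmul r k c l =>
    have h : ∀ k : A.C₁, A.tmul₄ r k c (A.tensor l) =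
        A.tmul₄ 1 k 1 1 * A.tmul₄ r 1 c (A.tensor l) := fun k => by
      rw [tmul₄_one_one_mul, mul_one, one_mul]
    rw [idrToIDRQ, extMap_tmul₄, extMap_tmul₄, h, h k, map_mul, map_mul, mk_tmul₄_C₁]

/-- The homomorphism `IDR(R) / J₁ → IDR_Q(R)`. -/
noncomputable def quotToIDRQ : A.IDR ⧸ A.J₁ →+* A.IDRQ :=
  Ideal.Quotient.lift A.J₁ A.idrToIDRQ.toRingHom A.J₁_le_ker

lemma quotToIDRQ_mk (a : A.IDR) :
    A.quotToIDRQ (Ideal.Quotient.mk A.J₁ a) = A.idrToIDRQ a := rfl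

lemma quotToIDRQ_isHom :
    IsIntegroDifferentialHom A.quotDer A.quotInt A.idrQDer A.idrQInt A.quotToIDRQ where
  map_der a := by
    obtain ⟨a, rfl⟩ := Ideal.Quotient.mk_surjective a
    exact A.idrToIDRQ_der a
  map_int a := by
    obtain ⟨a, rfl⟩ := Ideal.Quotient.mk_surjective a
    exact A.idrToIDRQ_int a

lemma quotToIDRQ_bijective : Function.Bijective A.quotToIDRQ := by
  constructor
  · rw [injective_iff_map_eq_zero]
    intro a ha
    obtain ⟨a, rfl⟩ := Ideal.Quotient.mk_surjective a
    rw [quotToIDRQ_mk] at ha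
    rw [← mk_extMap_idrToIDRQ, ha, map_zero, map_zero]
  · intro b
    obtain ⟨a, rfl⟩ := A.idrToIDRQ_surjective b
    exact ⟨Ideal.Quotient.mk A.J₁ a, rfl⟩

/-- The elements of `IDR(R)` on which the two composites agree form a subring closed under `∫`. Once
it contains the image of `R` it is everything; compatibility with `∂` plays no role. -/
lemma quot_hom_ext {φ φ' : A.IDR ⧸ A.J₁ →+* A.IDRQ}
    (hφ : IsIntegroDifferentialHom A.quotDer A.quotInt A.idrQDer A.idrQInt φ)
    (hφ' : IsIntegroDifferentialHom A.quotDer A.quotInt A.idrQDer A.idrQInt φ')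
    (h : ∀ r, φ (Ideal.Quotient.mk A.J₁ (A.idrι r)) = φ' (Ideal.Quotient.mk A.J₁ (A.idrι r))) :
    φ = φ' := by
  refine Ideal.Quotient.ringHom_ext (RingHom.ext fun a => ?_)
  refine mem_of_ι_mem_of_int_mem (S := RingHom.eqLocus (φ.comp (Ideal.Quotient.mk A.J₁))
    (φ'.comp (Ideal.Quotient.mk A.J₁))) h (fun b hb => ?_) a
  have hb' : φ (Ideal.Quotient.mk A.J₁ b) = φ' (Ideal.Quotient.mk A.J₁ b) := hb
  change φ (A.quotInt (Ideal.Quotient.mk A.J₁ b)) = φ' (A.quotInt (Ideal.Quotient.mk A.J₁ b))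
  rw [hφ.map_int, hφ'.map_int, hb']

/-- In `IDR(R)` the same computation would leave the constant `ε(Q∂r)`, which is the reason for the
choice of generators of `J₁`. -/
lemma idrQInt_idrQι_der (r : R) :
    A.idrQInt (A.idrQι (A.der r)) = A.idrQι (A.Q (A.der r)) := by
  rw [idrQι, extι_apply, extι_apply, idrQInt_nil, toRT_der, tensor, word_cons, map_zero, zero_mul,
    tmul₄_eq A 1 1 1 0, map_zero, tmul₃_zero₂, add_zero]

lemma idrQι_injective : Function.Injective A.idrQι :=
  A.extι_injective (SymmetricAlgebra.algebraMapInv :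
    SymmetricAlgebra A.Const (A.RJ ⊗[A.Const] A.PosT) →ₐ[A.Const] A.Const)

end QuasiIntegroDifferentialRing

end IDRing

/-! ### Assembly of the theorem. -/

theorem mainTheorem3 {R : Type*} [CommRing R] (A : IDRing.QuasiIntegroDifferentialRing R) :
    IDRing.IsIntegroDifferentialRing A.IDRQ A.idrQDer A.idrQInt ∧
    (Function.Injective A.idrQι ∧
      (∀ f : R, A.idrQDer (A.idrQι f) = A.idrQι (A.der f)) ∧
      ∀ f ∈ Set.range A.der, A.idrQInt (A.idrQι f) = A.idrQι (A.Q f)) ∧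
    ∃ ψ : A.IDR ⧸ A.J₁ →+* A.IDRQ,
      IDRing.IsIntegroDifferentialHom A.quotDer A.quotInt A.idrQDer A.idrQInt ψ ∧
      (∀ f : R, ψ (Ideal.Quotient.mk A.J₁ (A.idrι f)) = A.idrQι f) ∧
      Function.Bijective ψ ∧
      ∀ φ : A.IDR ⧸ A.J₁ →+* A.IDRQ,
        IDRing.IsIntegroDifferentialHom A.quotDer A.quotInt A.idrQDer A.idrQInt φ →
        (∀ f : R, φ (Ideal.Quotient.mk A.J₁ (A.idrι f)) = A.idrQι f) → φ = ψ := by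
  have hι : ∀ f : R, A.quotToIDRQ (Ideal.Quotient.mk A.J₁ (A.idrι f)) = A.idrQι f :=
    fun f => A.extMap_extι A.C₁toC₁Q f
  refine ⟨A.ext_isIntegroDifferentialRing A.eps₁Q, ⟨A.idrQι_injective, fun f => ?_, ?_⟩,
    A.quotToIDRQ, A.quotToIDRQ_isHom, hι, A.quotToIDRQ_bijective, fun φ hφ h => ?_⟩
  · exact A.idrQDer_nil f 1 1
  · rintro _ ⟨r, rfl⟩
    exact A.idrQInt_idrQι_der r
  · exact A.quot_hom_ext hφ A.quotToIDRQ_isHom fun r => (h r).trans (hι r).symm
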